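/- Let $\eta=\mathrm{d}z_0\wedge\mathrm{d}z_1$ on $\mathbb{C}^2$ and $\omega=z_0\,\mathrm{d}z_1+\mathrm{d}z_2$ on $\mathbb{C}^3$. Let $\mathrm{Bir}(\mathbb{C}^2)_\eta$ and $\mathrm{Bir}(\mathbb{C}^3)_\omega$ be the groups of birational self-maps $\varphi$ of $\mathbb{C}^2$, resp. $\phi$ of $\mathbb{C}^3$, with $\varphi^*\eta=\eta$, resp. $\phi^*\omega=\omega$. An element $(\phi_0,\phi_1)$ of $\mathrm{Bir}(\mathbb{C}^2)_\eta$ is called *exact* if there is a rational function $\phi_2$ on $\mathbb{C}^3$ such that $(\phi_0(z_0,z_1),\phi_1(z_0,z_1),\phi_2)$ belongs to $\mathrm{Bir}(\mathbb{C}^3)_\omega$. View $\mathbb{C}^2$ as the chart $z_2=1$ of $\mathbb{P}^2$, and let $\mathrm{\mathring{B}ir}_2(\mathbb{P}^2)$ be the set of birational self-maps of $\mathbb{P}^2$ of degree exactly $2$, i.e. those given by three quadratic forms without common factor, with the Zariski topology induced by the coefficients of these forms (a point of $\mathbb{P}^{17}$). Let $\tau=(z_0z_2+z_1^2:z_1z_2:z_2^2)$.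 For pairs $(\mathfrak{g},\mathfrak{h})\in\mathrm{Aut}(\mathbb{P}^2)\times\mathrm{Aut}(\mathbb{P}^2)=\mathrm{PGL}(3,\mathbb{C})\times\mathrm{PGL}(3,\mathbb{C})$ with matrices $$\begin{pmatrix}\gamma_0&\gamma_1&\gamma_2\\ \gamma_3&\gamma_4&\gamma_5\\ \gamma_6&\gamma_7&\gamma_8\end{pmatrix},\qquad \begin{pmatrix}\beta_0&\beta_1&\beta_2\\ \beta_3&\beta_4&\beta_5\\ \beta_6&\beta_7&\beta_8\end{pmatrix},$$ let $\Upsilon$ be the set of those with $$\gamma_6=0,\quad \gamma_7\beta_3+\gamma_8\beta_6=0,\quad \gamma_7\beta_4+\gamma_8\beta_7=0,\quad \det\mathfrak{g}\,\det\mathfrak{h}=(\gamma_7\beta_5+\gamma_8\beta_8)^3 .$$ Then: 1. A generic element of $\mathrm{\mathring{B}ir}_2(\mathbb{P}^2)\cap\mathrm{Bir}(\mathbb{C}^2)_\eta$ is not exact: this set has a nonempty, dense, Zariski-open subset none of whose elements is exact. 2. $\mathrm{\mathring{B}ir}_2(\mathbb{P}^2)\cap\mathrm{Bir}(\mathbb{C}^2)_\eta=\{\mathfrak{g}\,\tau\,\mathfrak{h}\mid(\mathfrak{g},\mathfrak{h})\in\Upsilon\}$.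 3. There is a nonempty (and dense) Zariski-open subset $\widetilde\Upsilon$ of $\Upsilon$ such that no $\mathfrak{g}\,\tau\,\mathfrak{h}$ with $(\mathfrak{g},\mathfrak{h})\in\widetilde\Upsilon$ is exact. -/

import Mathlib

open scoped KaehlerDifferential

noncomputable section

namespace ContactBir

open MvPolynomial

/-! ### Birational self-maps of affine space -/

/-- The field `ℂ(z₀, …, z_{n-1})` of rational functions in `n` variables. -/
abbrev RatFun (n : ℕ) : Type := FractionRing (MvPolynomial (Fin n) ℂ)

/-- The coordinate function `z_i`. -/
def coord {n : ℕ} (i : Fin n) : RatFun n := algebraMap (MvPolynomial (Fin n) ℂ) (RatFun n) (X i)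

/-- A tuple `φ = (φ₀, …, φ_{n-1})` of rational functions is a birational self-map of `ℂⁿ` if the
pullback `φ^* : F ↦ F ∘ φ`, which sends `z_i` to `φ_i`, is a well defined automorphism of the field
of rational functions. -/
def IsBirational {n : ℕ} (φ : Fin n → RatFun n) : Prop :=
  ∃ e : RatFun n ≃ₐ[ℂ] RatFun n, ∀ i, e (coord i) = φ i

/-- The differential `df` of a rational function, a rational (Kähler) `1`-form. -/
def dd {n : ℕ} (f : RatFun n) : Ω[RatFun n⁄ℂ] := KaehlerDifferential.D ℂ (RatFun n) f

/-- The wedge product of two rational `1`-forms, a rational `2`-form. -/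
def wedge {n : ℕ} (α β : Ω[RatFun n⁄ℂ]) : ⋀[RatFun n]^2 (Ω[RatFun n⁄ℂ]) :=
  exteriorPower.ιMulti (RatFun n) 2 ![α, β]

/-- `Bir(ℂ²)_η`: the birational maps `φ` of `ℂ²` with `φ^* η = η`, for `η = dz₀ ∧ dz₁`. -/
def BirEta : Set (Fin 2 → RatFun 2) :=
  {φ | IsBirational φ ∧ wedge (dd (φ 0)) (dd (φ 1)) = wedge (dd (coord 0)) (dd (coord 1))}

/-- `Bir(ℂ³)_ω`: the birational maps `Φ` of `ℂ³` with `Φ^* ω = ω`, for `ω = z₀ dz₁ + dz₂`. -/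
def BirOmega : Set (Fin 3 → RatFun 3) :=
  {Φ | IsBirational Φ ∧
    Φ 0 • dd (Φ 1) + dd (Φ 2) = coord (n := 3) 0 • dd (coord (n := 3) 1) + dd (coord 2)}

/-- The inclusion `ℂ(z₀, z₁) ⊆ ℂ(z₀, z₁, z₂)`. -/
def inclRat : RatFun 2 →+* RatFun 3 :=
  IsFractionRing.map (A := MvPolynomial (Fin 2) ℂ) (B := MvPolynomial (Fin 3) ℂ)
    (j := (rename Fin.castSucc : MvPolynomial (Fin 2) ℂ →ₐ[ℂ] MvPolynomial (Fin 3) ℂ).toRingHom)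
    (rename_injective _ (Fin.castSucc_injective 2))

/-- `φ` is exact: it is an element of `Bir(ℂ²)_η` and it lifts to `Bir(ℂ³)_ω`, i.e. it is the
projection to the first two components of some element of `Bir(ℂ³)_ω`. -/
def IsExact (φ : Fin 2 → RatFun 2) : Prop :=
  φ ∈ BirEta ∧ ∃ Φ ∈ BirOmega, ∀ i : Fin 2, Φ i.castSucc = inclRat (φ i)

/-! ### Rational self-maps of the projective plane in homogeneous coordinates -/

/-- The map `f = (f₀ : f₁ : f₂)` in the affine chart `z₂ = 1`. -/
def toAffine (f : Fin 3 → MvPolynomial (Fin 3) ℂ) : Fin 2 → RatFun 2 := fun i =>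
  aeval ![coord (n := 2) 0, coord 1, 1] (f i.castSucc) /
    aeval ![coord (n := 2) 0, coord 1, 1] (f (Fin.last 2))

/-- `φ` is, in the chart `z₂ = 1`, the rational map `(f₀ : f₁ : f₂)` of degree exactly `d`: the
`f_i` are homogeneous of degree `d` without common factor. -/
def IsGivenBy (d : ℕ) (f : Fin 3 → MvPolynomial (Fin 3) ℂ) (φ : Fin 2 → RatFun 2) : Prop :=
  (∀ i, (f i).IsHomogeneous d) ∧ (∀ p, (∀ i, p ∣ f i) → IsUnit p) ∧ f (Fin.last 2) ≠ 0 ∧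
    φ = toAffine f

/-- The elements of `Bir(ℂ²)_η` which are of degree exactly `2` as birational maps of `ℙ²`. -/
def QuadBirEta : Set (Fin 2 → RatFun 2) :=
  {φ | φ ∈ BirEta ∧ ∃ f, IsGivenBy 2 f φ}

/-- Composition of maps given by homogeneous polynomials. -/
def compTriple (f g : Fin 3 → MvPolynomial (Fin 3) ℂ) : Fin 3 → MvPolynomial (Fin 3) ℂ :=
  fun i => bind₁ g (f i)

/-- The linear map of homogeneous coordinates with matrix `A`. -/
def linTriple (A : Matrix (Fin 3) (Fin 3) ℂ) : Fin 3 → MvPolynomial (Fin 3) ℂ :=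
  fun i => ∑ j, C (A i j) * X j

/-- `τ = (z₀ z₂ + z₁² : z₁ z₂ : z₂²)`. -/
def tauTriple : Fin 3 → MvPolynomial (Fin 3) ℂ :=
  ![X 0 * X 2 + X 1 ^ 2, X 1 * X 2, X 2 ^ 2]

/-- The map `𝔤 τ 𝔥`, in the chart `z₂ = 1`, for `𝔤`, `𝔥` the automorphisms of `ℙ²` with matrices
`A` and `B`. -/
def gTauH (A B : GL (Fin 3) ℂ) : Fin 2 → RatFun 2 :=
  toAffine (compTriple (linTriple A.val) (compTriple tauTriple (linTriple B.val)))

/-- `Aut(ℙ²) = PGL(3, ℂ)`. -/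
abbrev AutP2 : Type := Matrix.ProjGenLinGroup (Fin 3) ℂ

/-- The class in `Aut(ℙ²)` of an invertible matrix. -/
def toAut (A : GL (Fin 3) ℂ) : AutP2 := Matrix.ProjGenLinGroup.mk A

/-- The family `Υ` of pairs `(𝔤, 𝔥)`, with matrices `A = (γ₀, …, γ₈)` and `B = (β₀, …, β₈)` (row by
row), such that `γ₆ = 0`, `γ₇ β₃ + γ₈ β₆ = 0`, `γ₇ β₄ + γ₈ β₇ = 0` and
`det A det B = (γ₇ β₅ + γ₈ β₈)³`. The conditions do not depend on the matrices chosen. -/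
def Upsilon : Set (AutP2 × AutP2) :=
  {x | ∃ A B : GL (Fin 3) ℂ, x = (toAut A, toAut B) ∧
    A.val 2 0 = 0 ∧
    A.val 2 1 * B.val 1 0 + A.val 2 2 * B.val 2 0 = 0 ∧
    A.val 2 1 * B.val 1 1 + A.val 2 2 * B.val 2 1 = 0 ∧
    A.val.det * B.val.det = (A.val 2 1 * B.val 1 2 + A.val 2 2 * B.val 2 2) ^ 3}

/-! ### Zariski topology

`coords x` is the set of all systems of (multi)homogeneous coordinates of the point `x`. A
polynomial `p` does not vanish at some system of coordinates of `x` exactly if one of its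
(multi)homogeneous components does not vanish at `x`, so the sets below are the open sets of the
Zariski topology of (a product of) projective spaces. -/

/-- `U` is a relatively Zariski-open subset of `S`. -/
def IsZariskiOpenIn {P σ : Type} (coords : P → Set (σ → ℂ)) (S U : Set P) : Prop :=
  ∃ I : Set (MvPolynomial σ ℂ), U = {x | x ∈ S ∧ ∃ p ∈ I, ∃ c ∈ coords x, eval c p ≠ 0}

/-- `U` is Zariski-dense in `S`: it meets every nonempty Zariski-open subset of `S`. -/
def IsZariskiDenseIn {P σ : Type} (coords : P → Set (σ → ℂ)) (S U : Set P) : Prop :=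
  ∀ V : Set P, IsZariskiOpenIn coords S V → V.Nonempty → (V ∩ U).Nonempty

/-- The coordinates of a pair of automorphisms of `ℙ²`: the entries of two matrices
representing them, i.e. the coordinates of `PGL(3, ℂ) × PGL(3, ℂ) ⊆ ℙ⁸ × ℙ⁸`. -/
def pairCoords (x : AutP2 × AutP2) : Set ((Fin 3 × Fin 3) ⊕ (Fin 3 × Fin 3) → ℂ) :=
  {c | ∃ A B : GL (Fin 3) ℂ, x = (toAut A, toAut B) ∧
    c = Sum.elim (fun ij => A.val ij.1 ij.2) (fun ij => B.val ij.1 ij.2)}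

/-- The coordinates of a quadratic map: the coefficients of homogeneous polynomials of degree `2`
without common factor that represent it, i.e. its coordinates in `ℙ¹⁷` (the coefficients of the
monomials of degree other than `2` are all `0`). -/
def quadCoords (φ : Fin 2 → RatFun 2) : Set (Fin 3 × (Fin 3 →₀ ℕ) → ℂ) :=
  {c | ∃ f, IsGivenBy 2 f φ ∧ c = fun im => (f im.1).coeff im.2}

end ContactBir

end

/-! For a map `(f₀ : f₁ : f₂)`, preserving `dz₀ ∧ dz₁` means that the determinant of `F, ∂₀F, ∂₁F`
equals `F₂³` in the chart `z₂ = 1` (`wedge_toAffine_iff`). When the forms are quadratic, Euler's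
identity makes the left side a cubic (`eval_jac_dehom`), whereas `f₂³` is a sextic. Comparing
degrees gives `f₂ = z₂ ℓ` with `ℓ` linear, and the cubic is `ℓ³`.

If `ℓ` is proportional to `z₂` (`isGTH_parallel`), or if it is not (`isGTH_transverse`), elementary
linear algebra together with the absence of a common factor writes `f` as `𝔤 τ 𝔥`; birationality is
not needed here. The Jacobian of `𝔤 τ 𝔥` is `det 𝔤 det 𝔥` times the cube of the last form `h₂` of
`𝔥` (`jac_gthTriple`). Equating it with `f₂³` gives exactly the equations of `Υ`, in both directions
(`upsilonEq_of_jac`, `wedge_gTauH`).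

Non-exactness is a residue computation. Contract `Φ₀ dΦ₁ + dΦ₂ = z₀ dz₁ + dz₂` with a constant field
along which `h₀` is constant and `h₂` has derivative `1`. If `γ₇ ≠ 0`, then `Φ₀ D(Φ₁)` has residue
`-det 𝔤 / γ₇³` along `h₂ = 0`, while a derivative has no residue there (`exists_residue`,
`dvd_of_mul_derivation_eq`). Hence `γ₇ ≠ 0` excludes exactness (`not_isExact_gTauH`).

This condition is open. It is dense because a one-parameter group of shears inserted between `𝔤` and
`𝔥` preserves `Υ` and makes `γ₇` nonzero for generic parameter (`UpsilonEq.shear`). In terms of the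
map it says that `f₂` is not a multiple of `z₂²` (`UpsilonEq.ne_zero_iff`). -/

lemma AlternatingMap.map_linearCombination_two {K M N : Type*} [CommRing K] [AddCommGroup M]
    [Module K M] [AddCommGroup N] [Module K N] (w : M [⋀^Fin 2]→ₗ[K] N) (p q r s : K) (u v : M) :
    w ![p • u + q • v, r • u + s • v] = (p * s - q * r) • w ![u, v] := by
  have e0 : ∀ x : M, w ![x, x] = 0 := fun x =>
    w.map_eq_zero_of_eq ![x, x] (i := 0) (j := 1) rfl (by decide)
  have e1 : ∀ x y z : M, w ![x + y, z] = w ![x, z] + w ![y, z] := fun x y z =>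
    w.map_vecCons_add _ x y
  have e2 : ∀ (c : K) (x z : M), w ![c • x, z] = c • w ![x, z] :=
    fun c x z => w.map_vecCons_smul _ c x
  have e3 : ∀ x y : M, w ![y, x] = - w ![x, y] := fun x y => by
    rw [← w.map_swap ![x, y] (i := 0) (j := 1) (by decide)]
    congr 1
    ext i
    fin_cases i <;> rfl
  rw [e1, e2, e2, e3 (r • u + s • v) u, e3 (r • u + s • v) v, e1, e1, e2, e2, e2, e2, e0, e0,
    e3 u v]
  module

namespace ContactBir

open MvPolynomial

/-! ### Partial derivatives of rational functions -/

/-- The differentials of the coordinates form a basis of the rational `1`-forms. -/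
noncomputable def coordBasis (n : ℕ) : Module.Basis (Fin n) (RatFun n) Ω[RatFun n⁄ℂ] :=
  ((KaehlerDifferential.mvPolynomialBasis ℂ (Fin n)).baseChange (RatFun n)).map
    (KaehlerDifferential.tensorKaehlerEquivOfFormallyEtale ℂ (MvPolynomial (Fin n) ℂ) (RatFun n))

lemma coordBasis_apply {n : ℕ} (i : Fin n) : coordBasis n i = dd (coord i) := by
  have : KaehlerDifferential.mvPolynomialBasis ℂ (Fin n) i =
      KaehlerDifferential.D ℂ _ (X i) := by
    rw [← KaehlerDifferential.mvPolynomialBasis ℂ (Fin n) |>.repr.injective.eq_iff]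
    simp
  simp [coordBasis, this, dd, coord]

/-- The partial derivative `∂/∂z_i` on rational functions. -/
noncomputable def partialD {n : ℕ} (i : Fin n) : Derivation ℂ (RatFun n) (RatFun n) :=
  ((coordBasis n).coord i).compDer (KaehlerDifferential.D ℂ (RatFun n))

lemma coordBasis_coord_dd {n : ℕ} (i : Fin n) (f : RatFun n) :
    (coordBasis n).coord i (dd f) = partialD i f := rfl

lemma partialD_coord {n : ℕ} (i j : Fin n) :
    partialD i (coord j) = if i = j then 1 else 0 := by
  rw [← coordBasis_coord_dd, ← coordBasis_apply]
  simp [Finsupp.single_apply, eq_comm]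

lemma dd_eq_sum {n : ℕ} (f : RatFun n) : dd f = ∑ i, partialD i f • dd (coord i) := by
  conv_lhs => rw [← (coordBasis n).sum_repr (dd f)]
  simp only [coordBasis_apply]
  rfl

lemma partialD_algebraMap {n : ℕ} (i : Fin n) (p : MvPolynomial (Fin n) ℂ) :
    partialD i (algebraMap _ (RatFun n) p) = algebraMap _ _ (pderiv i p) := by
  induction p using MvPolynomial.induction_on with
  | C a =>
    have : algebraMap _ (RatFun n) (C a : MvPolynomial (Fin n) ℂ) = algebraMap ℂ _ a :=
      (IsScalarTower.algebraMap_apply ℂ (MvPolynomial (Fin n) ℂ) (RatFun n) a).symm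
    rw [this, Derivation.map_algebraMap, pderiv_C, map_zero]
  | add p q hp hq => simp only [map_add, hp, hq]
  | mul_X p j hp =>
    have : partialD i (algebraMap _ (RatFun n) (X j : MvPolynomial (Fin n) ℂ)) =
        algebraMap _ _ (pderiv i (X j : MvPolynomial (Fin n) ℂ)) := by
      refine (partialD_coord i j).trans ?_
      rcases eq_or_ne i j with rfl | h
      · simp
      · simp [h, pderiv_X_of_ne (Ne.symm h)]
    simp only [map_mul, Derivation.leibniz, smul_eq_mul, map_add, hp, this]

lemma wedge_eq_iff (a b : RatFun 2) :
    wedge (dd a) (dd b) = wedge (dd (coord 0)) (dd (coord 1)) ↔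
      partialD 0 a * partialD 1 b - partialD 1 a * partialD 0 b = 1 := by
  constructor
  · intro h
    -- Pairing both 2-forms with the two dual coordinate functionals turns the equation into one of
    -- determinants.
    have h2 := congrArg (exteriorPower.alternatingMapToDual (RatFun 2) Ω[RatFun 2⁄ℂ] 2
      ![(coordBasis 2).coord 0, (coordBasis 2).coord 1]) h
    simp only [wedge, exteriorPower.alternatingMapToDual_apply_ιMulti, Matrix.det_fin_two,
      Matrix.of_apply, Matrix.cons_val_zero, Matrix.cons_val_one, coordBasis_coord_dd,
      partialD_coord] at h2
    simpa using h2
  · intro h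
    have key := (exteriorPower.ιMulti (RatFun 2) 2 (M := Ω[RatFun 2⁄ℂ])).map_linearCombination_two
    rw [dd_eq_sum a, dd_eq_sum b]
    simp only [Fin.sum_univ_two, wedge, key, h, one_smul]

/-! ### Rational maps of the plane in homogeneous coordinates -/

/-- Dehomogenization with respect to the last variable. -/
noncomputable def dehom : MvPolynomial (Fin 3) ℂ →ₐ[ℂ] MvPolynomial (Fin 2) ℂ :=
  aeval ![X 0, X 1, 1]

lemma aeval_coord_eq (p : MvPolynomial (Fin 3) ℂ) :
    aeval ![coord (n := 2) 0, coord 1, 1] p = algebraMap _ (RatFun 2) (dehom p) := by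
  have : (aeval ![coord (n := 2) 0, coord 1, 1] : MvPolynomial (Fin 3) ℂ →ₐ[ℂ] RatFun 2) =
      (IsScalarTower.toAlgHom ℂ (MvPolynomial (Fin 2) ℂ) (RatFun 2)).comp dehom := by
    ext i
    fin_cases i <;> simp [dehom, coord]
  rw [this]
  rfl

lemma eval_dehom (p : MvPolynomial (Fin 3) ℂ) (v : Fin 2 → ℂ) :
    eval v (dehom p) = eval ![v 0, v 1, 1] p := by
  have : (eval v).comp (dehom : MvPolynomial (Fin 3) ℂ →ₐ[ℂ] MvPolynomial (Fin 2) ℂ).toRingHom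
      = eval ![v 0, v 1, 1] := by
    ext i
    · simp [dehom]
    · fin_cases i <;> simp [dehom]
  exact congrArg (fun g => g p) this

lemma eval_smul_of_isHomogeneous {σ : Type*} {p : MvPolynomial σ ℂ} {d : ℕ}
    (hp : p.IsHomogeneous d) (c : ℂ) (v : σ → ℂ) : eval (c • v) p = c ^ d * eval v p := by
  rw [eval_eq, eval_eq, Finset.mul_sum]
  refine Finset.sum_congr rfl fun m hm => ?_
  have h1 : ∑ i ∈ m.support, m i = d := by
    have := hp (mem_support_iff.mp hm)
    simpa [Finsupp.weight_apply, Finsupp.sum] using this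
  simp only [Pi.smul_apply, smul_eq_mul, mul_pow, Finset.prod_mul_distrib]
  rw [Finset.prod_pow_eq_pow_sum, h1]
  ring

/-- By scaling, a form is determined off `z₂ = 0` by its values on the chart. Multiplying by `X 2`
disposes of the points at infinity. -/
lemma dehom_ne_zero {p : MvPolynomial (Fin 3) ℂ} {d : ℕ} (hp : p.IsHomogeneous d) (h : p ≠ 0) :
    dehom p ≠ 0 := by
  intro h0
  apply h
  have h1 : p * X 2 = 0 := by
    apply MvPolynomial.funext
    intro v
    by_cases hv : v 2 = 0
    · simp [hv]
    have e : v = v 2 • ![v 0 / v 2, v 1 / v 2, 1] := by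
      ext i
      fin_cases i <;> simp <;> field_simp
    have h2 := eval_dehom p ![v 0 / v 2, v 1 / v 2]
    rw [h0] at h2
    simp only [map_zero, Matrix.cons_val_zero, Matrix.cons_val_one] at h2
    rw [map_mul, e, eval_smul_of_isHomogeneous hp, ← h2]
    simp
  simpa [X_ne_zero] using h1

/-- The Jacobian determinant of the homogeneous map `(F₀ : F₁ : F₂)` in affine coordinates. -/
noncomputable def jac (F : Fin 3 → MvPolynomial (Fin 2) ℂ) : MvPolynomial (Fin 2) ℂ :=
  Matrix.det (Matrix.of ![F, fun i => pderiv 0 (F i), fun i => pderiv 1 (F i)])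

lemma toAffine_apply (f : Fin 3 → MvPolynomial (Fin 3) ℂ) (i : Fin 2) :
    toAffine f i = algebraMap _ (RatFun 2) (dehom (f i.castSucc)) /
      algebraMap _ (RatFun 2) (dehom (f 2)) := by
  simp only [toAffine, aeval_coord_eq]
  rfl

/-- The quotient rule: the Jacobian of `(F₀/F₂, F₁/F₂)` is `jac F / F₂³`. -/
lemma wedge_toAffine_iff (f : Fin 3 → MvPolynomial (Fin 3) ℂ) (h : dehom (f 2) ≠ 0) :
    wedge (dd (toAffine f 0)) (dd (toAffine f 1)) = wedge (dd (coord 0)) (dd (coord 1)) ↔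
      jac (fun i => dehom (f i)) = dehom (f 2) ^ 3 := by
  rw [wedge_eq_iff, toAffine_apply, toAffine_apply]
  have h' : algebraMap _ (RatFun 2) (dehom (f 2)) ≠ 0 := by
    simpa using h
  simp only [Derivation.leibniz_div, partialD_algebraMap, smul_eq_mul]
  rw [← (FaithfulSMul.algebraMap_injective (MvPolynomial (Fin 2) ℂ) (RatFun 2)).eq_iff]
  simp only [jac, Matrix.det_fin_three, Matrix.of_apply, map_add, map_sub, map_mul, map_pow,
    Matrix.cons_val, Fin.castSucc_zero, Fin.castSucc_one]
  generalize algebraMap (MvPolynomial (Fin 2) ℂ) (RatFun 2) = g at *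
  field_simp
  constructor <;> intro h3
  · apply mul_left_cancel₀ h'
    linear_combination h3
  · linear_combination g (dehom (f 2)) * h3

/-! ### The equations of `Υ` and the quadratic forms of `𝔤 τ 𝔥` -/

/-- The conditions on two matrices which define `Υ`. -/
def UpsilonEq (A B : Matrix (Fin 3) (Fin 3) ℂ) : Prop :=
  A 2 0 = 0 ∧
    A 2 1 * B 1 0 + A 2 2 * B 2 0 = 0 ∧
    A 2 1 * B 1 1 + A 2 2 * B 2 1 = 0 ∧
    A.det * B.det = (A 2 1 * B 1 2 + A 2 2 * B 2 2) ^ 3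

lemma toAut_eq_toAut_iff {A B : GL (Fin 3) ℂ} :
    toAut A = toAut B ↔ ∃ c : ℂ, c ≠ 0 ∧ B.val = c • A.val := by
  rw [toAut, toAut, Matrix.ProjGenLinGroup.mk_eq_mk_iff]
  constructor
  · rintro ⟨u, rfl⟩
    refine ⟨u, u.ne_zero, ?_⟩
    ext i j
    simp [Matrix.scalar_apply, Matrix.mul_diagonal, mul_comm]
  · rintro ⟨c, hc, h⟩
    refine ⟨Units.mk0 c hc, ?_⟩
    apply Units.ext
    rw [h]
    ext i j
    simp [Matrix.scalar_apply, Matrix.mul_diagonal, mul_comm]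

lemma UpsilonEq.smul {A B : Matrix (Fin 3) (Fin 3) ℂ} (h : UpsilonEq A B) (c d : ℂ) :
    UpsilonEq (c • A) (d • B) := by
  obtain ⟨h1, h2, h3, h4⟩ := h
  refine ⟨by simp [h1], ?_, ?_, ?_⟩
  · simp only [Matrix.smul_apply, smul_eq_mul]
    linear_combination c * d * h2
  · simp only [Matrix.smul_apply, smul_eq_mul]
    linear_combination c * d * h3
  · simp only [Matrix.det_smul, Fintype.card_fin, Matrix.smul_apply, smul_eq_mul]
    linear_combination c ^ 3 * d ^ 3 * h4

lemma mem_Upsilon_iff (A B : GL (Fin 3) ℂ) :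
    (toAut A, toAut B) ∈ Upsilon ↔ UpsilonEq A.val B.val := by
  constructor
  · rintro ⟨A', B', h, h'⟩
    obtain ⟨hA, hB⟩ := Prod.mk.inj h
    obtain ⟨c, -, hc⟩ := toAut_eq_toAut_iff.1 hA.symm
    obtain ⟨d, -, hd⟩ := toAut_eq_toAut_iff.1 hB.symm
    rw [hc, hd]
    exact UpsilonEq.smul h' c d
  · intro h
    exact ⟨A, B, rfl, h⟩

/-- The triple of quadratic forms of the map `𝔤 τ 𝔥`. -/
noncomputable def gthTriple (A B : Matrix (Fin 3) (Fin 3) ℂ) :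
    Fin 3 → MvPolynomial (Fin 3) ℂ :=
  compTriple (linTriple A) (compTriple tauTriple (linTriple B))

lemma gthTriple_apply (A B : Matrix (Fin 3) (Fin 3) ℂ) (i : Fin 3) :
    gthTriple A B i = C (A i 0) * (linTriple B 0 * linTriple B 2 + linTriple B 1 ^ 2) +
      C (A i 1) * (linTriple B 1 * linTriple B 2) + C (A i 2) * linTriple B 2 ^ 2 := by
  simp [gthTriple, compTriple, linTriple, tauTriple, Fin.sum_univ_three]

lemma isHomogeneous_linTriple (B : Matrix (Fin 3) (Fin 3) ℂ) (i : Fin 3) :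
    (linTriple B i).IsHomogeneous 1 :=
  IsHomogeneous.sum _ _ _ fun j _ => by
    simpa using (isHomogeneous_C _ (B i j)).mul (isHomogeneous_X ℂ j)

lemma isHomogeneous_gthTriple (A B : Matrix (Fin 3) (Fin 3) ℂ) (i : Fin 3) :
    (gthTriple A B i).IsHomogeneous 2 := by
  have hl := isHomogeneous_linTriple B
  have hc : ∀ (a : ℂ) {p : MvPolynomial (Fin 3) ℂ}, p.IsHomogeneous 2 →
      (C a * p).IsHomogeneous 2 := fun a p hp => by
    simpa using (isHomogeneous_C _ a).mul hp
  rw [gthTriple_apply]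
  exact ((hc _ (((hl 0).mul (hl 2)).add (by simpa using (hl 1).pow 2))).add
    (hc _ ((hl 1).mul (hl 2)))).add (hc _ (by simpa using (hl 2).pow 2))

lemma dehom_linTriple (B : Matrix (Fin 3) (Fin 3) ℂ) (i : Fin 3) :
    dehom (linTriple B i) = C (B i 0) * X 0 + C (B i 1) * X 1 + C (B i 2) := by
  simp [linTriple, dehom, Fin.sum_univ_three, algebraMap_eq]

lemma dehom_gthTriple (A B : Matrix (Fin 3) (Fin 3) ℂ) (i : Fin 3) :
    dehom (gthTriple A B i) = C (A i 0) * (dehom (linTriple B 0) * dehom (linTriple B 2) +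
      dehom (linTriple B 1) ^ 2) +
      C (A i 1) * (dehom (linTriple B 1) * dehom (linTriple B 2)) +
      C (A i 2) * dehom (linTriple B 2) ^ 2 := by
  have hC : ∀ a : ℂ, dehom (C a) = C a := fun a => by simp [dehom, algebraMap_eq]
  simp only [gthTriple_apply, map_add, map_mul, map_pow, hC]

/-- The Jacobian is multiplicative under composition: `A` and `B` contribute their determinants, and
`τ` contributes the cube of its last coordinate. -/
lemma jac_gthTriple (A B : Matrix (Fin 3) (Fin 3) ℂ) :
    jac (fun i => dehom (gthTriple A B i)) =
      C (A.det * B.det) * dehom (linTriple B 2) ^ 3 := by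
  have h0 : ∀ i, pderiv 0 (dehom (linTriple B i)) = C (B i 0) := fun i => by
    simp [dehom_linTriple]
  have h1 : ∀ i, pderiv 1 (dehom (linTriple B i)) = C (B i 1) := fun i => by
    simp [dehom_linTriple]
  set H := fun i => dehom (linTriple B i) with hH
  have hB : C (B.det) = Matrix.det (Matrix.of ![H, fun i => C (B i 0), fun i => C (B i 1)]) := by
    simp only [Matrix.det_fin_three, Matrix.of_apply, Matrix.cons_val, hH, dehom_linTriple,
      map_add, map_sub, map_mul]
    ring
  have e : ∀ i, H i = dehom (linTriple B i) := fun i => rfl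
  have : jac (fun i => dehom (gthTriple A B i)) = C A.det *
      Matrix.det (Matrix.of ![![H 0 * H 2 + H 1 ^ 2, H 1 * H 2, H 2 ^ 2],
        ![C (B 0 0) * H 2 + H 0 * C (B 2 0) + 2 * H 1 * C (B 1 0),
          C (B 1 0) * H 2 + H 1 * C (B 2 0), 2 * H 2 * C (B 2 0)],
        ![C (B 0 1) * H 2 + H 0 * C (B 2 1) + 2 * H 1 * C (B 1 1),
          C (B 1 1) * H 2 + H 1 * C (B 2 1), 2 * H 2 * C (B 2 1)]]) := by
    have hT : C A.det = (C.mapMatrix A : Matrix _ _ (MvPolynomial (Fin 2) ℂ)).transpose.det := by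
      rw [Matrix.det_transpose]
      exact RingHom.map_det _ _
    rw [mul_comm, hT, ← Matrix.det_mul, jac]
    congr 1
    ext1 j i
    simp only [dehom_gthTriple, ← e, Matrix.mul_apply, Fin.sum_univ_three]
    fin_cases j <;>
      simp [Matrix.of_apply, h0, h1, e, Derivation.leibniz_pow] <;> ring
  rw [this, map_mul, hB]
  simp only [Matrix.det_fin_three, Matrix.of_apply, Matrix.cons_val]
  ring

lemma eval_linTriple (B : Matrix (Fin 3) (Fin 3) ℂ) (i : Fin 3) (v : Fin 3 → ℂ) :
    eval v (linTriple B i) = B.mulVec v i := by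
  simp [linTriple, Matrix.mulVec, dotProduct]

lemma linTriple_inv (B : GL (Fin 3) ℂ) (i : Fin 3) :
    ∑ j, C (B⁻¹.val i j) * linTriple B.val j = X i := by
  apply MvPolynomial.funext
  intro v
  have : (B⁻¹.val).mulVec (B.val.mulVec v) = v := by
    rw [Matrix.mulVec_mulVec, ← Units.val_mul, inv_mul_cancel, Units.val_one, Matrix.one_mulVec]
  simp only [map_sum, map_mul, eval_C, eval_linTriple, eval_X]
  exact congrFun this i

lemma exists_eval_linTriple_eq (B : GL (Fin 3) ℂ) (w : Fin 3 → ℂ) :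
    ∃ v, ∀ i, eval v (linTriple B.val i) = w i := by
  refine ⟨(B⁻¹.val).mulVec w, fun i => ?_⟩
  rw [eval_linTriple, Matrix.mulVec_mulVec, ← Units.val_mul, mul_inv_cancel, Units.val_one,
    Matrix.one_mulVec]

lemma linTriple_ne_zero (B : GL (Fin 3) ℂ) (i : Fin 3) : linTriple B.val i ≠ 0 := by
  intro h
  obtain ⟨v, hv⟩ := exists_eval_linTriple_eq B 1
  simpa [h] using hv i

lemma prime_of_totalDegree_eq_one {σ k : Type*} [Field k] {p : MvPolynomial σ k}
    (h : p.totalDegree = 1) : Prime p := by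
  refine (irreducible_of_totalDegree_eq_one h fun x hx => ?_).prime
  rw [isUnit_iff_ne_zero]
  rintro rfl
  have : p = 0 := by
    ext m
    simpa using hx m
  simp [this] at h

lemma prime_linTriple (B : GL (Fin 3) ℂ) (i : Fin 3) : Prime (linTriple B.val i) :=
  prime_of_totalDegree_eq_one
    ((isHomogeneous_linTriple B.val i).totalDegree (linTriple_ne_zero B i))

/-- Undoing `A`, a common factor divides `h₂²` and `h₀ h₂ + h₁²`. Since `h₂` is prime, a nonunit
factor would give `h₂ ∣ h₁`, against the independence of the rows of `B`. -/
lemma isUnit_of_dvd_gthTriple (A B : GL (Fin 3) ℂ) {p : MvPolynomial (Fin 3) ℂ}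
    (hp : ∀ i, p ∣ gthTriple A.val B.val i) : IsUnit p := by
  set T : Fin 3 → MvPolynomial (Fin 3) ℂ := fun i => bind₁ (linTriple B.val) (tauTriple i) with hT
  have hTi : ∀ i, p ∣ T i := fun i => by
    have h1 : T i = ∑ j, C (A⁻¹.val i j) * gthTriple A.val B.val j := by
      have := congrArg (bind₁ T) (linTriple_inv A i)
      rw [bind₁_X_right, map_sum] at this
      rw [← this]
      refine Finset.sum_congr rfl fun j _ => ?_
      rw [map_mul, bind₁_C_right]
      rfl
    rw [h1]
    exact Finset.dvd_sum fun j _ => Dvd.dvd.mul_left (hp j) _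
  have h0 := hTi 0
  have h2 := hTi 2
  simp only [hT, tauTriple, Matrix.cons_val, map_add, map_mul, map_pow, bind₁_X_right] at h0 h2
  have hpr := prime_linTriple B 2
  obtain ⟨n, hn, ha⟩ := (dvd_prime_pow hpr 2).1 h2
  rcases Nat.eq_zero_or_pos n with rfl | hpos
  · rw [pow_zero] at ha
    exact ha.symm.isUnit isUnit_one
  exfalso
  have h3 : linTriple B.val 2 ∣ p := (dvd_pow_self _ hpos.ne').trans ha.symm.dvd
  have h4 : linTriple B.val 2 ∣ linTriple B.val 1 ^ 2 :=
    (dvd_add_right (Dvd.intro_left _ rfl)).1 (h3.trans h0)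
  obtain ⟨q, hq⟩ := hpr.dvd_of_dvd_pow h4
  obtain ⟨v, hv⟩ := exists_eval_linTriple_eq B ![0, 1, 0]
  have := congrArg (eval v) hq
  rw [map_mul, hv, hv] at this
  simp at this

lemma gthTriple_ne_zero (A B : GL (Fin 3) ℂ) (i : Fin 3) : gthTriple A.val B.val i ≠ 0 := by
  intro h
  have h1 : ∀ w : Fin 3 → ℂ, A.val i 0 * (w 0 * w 2 + w 1 ^ 2) + A.val i 1 * (w 1 * w 2) +
      A.val i 2 * w 2 ^ 2 = 0 := fun w => by
    obtain ⟨v, hv⟩ := exists_eval_linTriple_eq B w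
    have := congrArg (eval v) h
    rw [gthTriple_apply] at this
    simpa [hv] using this
  have h2 := h1 ![0, 0, 1]
  have h3 := h1 ![0, 1, 0]
  have h4 := h1 ![0, 1, 1]
  simp at h2 h3 h4
  simp [h2, h3] at h4
  have h5 : A.val.det = 0 := Matrix.det_eq_zero_of_row_eq_zero i fun j => by
    fin_cases j <;> simp [h2, h3, h4]
  exact (Matrix.isUnits_det_units A).ne_zero h5

lemma isGivenBy_gTauH (A B : GL (Fin 3) ℂ) :
    IsGivenBy 2 (gthTriple A.val B.val) (gTauH A B) :=
  ⟨isHomogeneous_gthTriple _ _, fun _ => isUnit_of_dvd_gthTriple A B, gthTriple_ne_zero A B _,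
    rfl⟩

/-- With `γ₆ = 0` the last form is `h₂ (γ₇ h₁ + γ₈ h₂)`, and the two linear equations of `Υ` say
that the second factor is a multiple of `z₂`. -/
lemma gthTriple_two {A B : Matrix (Fin 3) (Fin 3) ℂ} (h : UpsilonEq A B) :
    gthTriple A B 2 = C (A 2 1 * B 1 2 + A 2 2 * B 2 2) * (X 2 * linTriple B 2) := by
  obtain ⟨h1, h2, h3, -⟩ := h
  have : C (A 2 1) * linTriple B 1 + C (A 2 2) * linTriple B 2 =
      C (A 2 1 * B 1 2 + A 2 2 * B 2 2) * X 2 := by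
    apply MvPolynomial.funext
    intro v
    simp only [map_add, map_mul, eval_C, eval_X, linTriple, Fin.sum_univ_three]
    linear_combination v 0 * h2 + v 1 * h3
  rw [gthTriple_apply, h1, C_0]
  linear_combination linTriple B 2 * this

lemma wedge_gTauH {A B : GL (Fin 3) ℂ} (h : UpsilonEq A.val B.val) :
    wedge (dd (gTauH A B 0)) (dd (gTauH A B 1)) = wedge (dd (coord 0)) (dd (coord 1)) := by
  refine (wedge_toAffine_iff (gthTriple A.val B.val) ?_).2 ?_
  · exact dehom_ne_zero (isHomogeneous_gthTriple _ _ _) (gthTriple_ne_zero A B 2)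
  · rw [jac_gthTriple, gthTriple_two h, h.2.2.2]
    simp [dehom, algebraMap_eq]
    ring

/-! ### Birationality of `𝔤 τ 𝔥` -/

lemma mem_of_sum_mem {F L : Type*} [Field F] [Field L] [Algebra F L] (K : IntermediateField F L)
    (A : GL (Fin 3) F) (v : Fin 3 → L)
    (h : ∀ i, ∑ j, algebraMap F L (A.val i j) * v j ∈ K) (i : Fin 3) : v i ∈ K := by
  have h1 : v i = ∑ j, algebraMap F L (A⁻¹.val i j) * ∑ k, algebraMap F L (A.val j k) * v k := by
    have h2 : (A⁻¹.val * A.val) = 1 := by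
      rw [← Units.val_mul, inv_mul_cancel, Units.val_one]
    have h3 : ((A⁻¹.val * A.val).map (algebraMap F L)).mulVec v = v := by
      rw [h2]
      simp
    rw [Matrix.map_mul, ← Matrix.mulVec_mulVec] at h3
    exact (congrFun h3 i).symm
  rw [h1]
  exact sum_mem fun j _ => mul_mem (K.algebraMap_mem _) (h j)

/-- If `n` functions generate a field of transcendence degree `n`, they are algebraically
independent, so `z_i ↦ φ_i` extends to an automorphism. -/
lemma isBirational_of_coord_mem {n : ℕ} (φ : Fin n → RatFun n)
    (h : ∀ i, coord i ∈ IntermediateField.adjoin ℂ (Set.range φ)) : IsBirational φ := by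
  have htop : IntermediateField.adjoin ℂ (Set.range φ) = ⊤ := by
    rw [eq_top_iff]
    intro x _
    obtain ⟨p, q, hq, rfl⟩ := IsFractionRing.div_surjective (A := MvPolynomial (Fin n) ℂ) x
    have hp : ∀ p : MvPolynomial (Fin n) ℂ, algebraMap _ (RatFun n) p ∈
        IntermediateField.adjoin ℂ (Set.range φ) := fun p => by
      induction p using MvPolynomial.induction_on with
      | C a =>
        have : algebraMap _ (RatFun n) (C a : MvPolynomial (Fin n) ℂ) = algebraMap ℂ _ a :=
          (IsScalarTower.algebraMap_apply ℂ (MvPolynomial (Fin n) ℂ) (RatFun n) a).symm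
        rw [this]
        exact IntermediateField.algebraMap_mem _ _
      | add p q hp hq => rw [map_add]; exact add_mem hp hq
      | mul_X p j hp => rw [map_mul]; exact mul_mem hp (h j)
    exact div_mem (hp p) (hp q)
  have := IsLocalization.isAlgebraic (R := MvPolynomial (Fin n) ℂ) (S := RatFun n)
    (nonZeroDivisors (MvPolynomial (Fin n) ℂ))
  have hb : IsTranscendenceBasis ℂ
      (fun i => algebraMap (MvPolynomial (Fin n) ℂ) (RatFun n) (X i)) :=
    (IsTranscendenceBasis.mvPolynomial (Fin n) ℂ).algebraMap_comp
  have halg : Algebra.IsAlgebraic (Algebra.adjoin ℂ (Set.range φ)) (RatFun n) := by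
    refine ⟨fun x => ?_⟩
    have hx : x ∈ IntermediateField.adjoin ℂ (Set.range φ) := htop ▸ IntermediateField.mem_top
    obtain ⟨r, hr, s, hs, rfl⟩ := IntermediateField.mem_adjoin_iff_div.1 hx
    rw [div_eq_mul_inv]
    exact (isAlgebraic_algebraMap (⟨r, hr⟩ : Algebra.adjoin ℂ (Set.range φ))).mul
      (isAlgebraic_algebraMap (⟨s, hs⟩ : Algebra.adjoin ℂ (Set.range φ))).inv
  have hind : AlgebraicIndependent ℂ φ :=
    (Algebra.IsAlgebraic.isTranscendenceBasis_of_lift_le_trdeg_of_finite ℂ φ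
      (by rw [← hb.lift_cardinalMk_eq_trdeg])).1
  refine ⟨hind.aevalEquivField.trans
    ((IntermediateField.equivOfEq htop).trans IntermediateField.topEquiv), fun i => ?_⟩
  have := hind.aevalEquivField_algebraMap_apply_coe (X i)
  rw [aeval_X] at this
  exact this

lemma isBirational_gTauH (A B : GL (Fin 3) ℂ) : IsBirational (gTauH A B) := by
  apply isBirational_of_coord_mem
  set K := IntermediateField.adjoin ℂ (Set.range (gTauH A B)) with hK
  set g := algebraMap (MvPolynomial (Fin 2) ℂ) (RatFun 2) with hg
  have hgC : ∀ a : ℂ, g (C a) = algebraMap ℂ (RatFun 2) a := fun a =>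
    (IsScalarTower.algebraMap_apply ℂ (MvPolynomial (Fin 2) ℂ) (RatFun 2) a).symm
  have hinj : ∀ {p : MvPolynomial (Fin 2) ℂ}, p ≠ 0 → g p ≠ 0 := fun h => by simpa [hg] using h
  set h : Fin 3 → RatFun 2 := fun i => g (dehom (linTriple B.val i)) with hh
  set F : RatFun 2 := g (dehom (gthTriple A.val B.val 2)) with hF
  have hF0 : F ≠ 0 := hinj (dehom_ne_zero (isHomogeneous_gthTriple _ _ _)
    (gthTriple_ne_zero A B 2))
  have hh2 : h 2 ≠ 0 := hinj (dehom_ne_zero (isHomogeneous_linTriple _ _) (linTriple_ne_zero B 2))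
  have hmem : ∀ i, g (dehom (gthTriple A.val B.val i)) / F ∈ K := fun i => by
    refine Fin.lastCases ?_ (fun j => ?_) i
    · rw [show Fin.last 2 = 2 from rfl, ← hF, div_self hF0]
      exact one_mem K
    · exact IntermediateField.subset_adjoin _ _ ⟨j, toAffine_apply _ j⟩
  -- Invert `A` first; quotients of the forms of `τ` then yield `h₁/h₂` and `h₀/h₂`.
  have hT : ∀ i,
      (![(h 0 * h 2 + h 1 ^ 2) / F, h 1 * h 2 / F, h 2 ^ 2 / F] : Fin 3 → RatFun 2) i ∈ K := by
    refine mem_of_sum_mem K A _ fun i => ?_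
    convert hmem i using 1
    simp only [Fin.sum_univ_three, Matrix.cons_val, dehom_gthTriple, map_add, map_mul, map_pow,
      hgC, hh]
    ring
  have h1 : h 1 / h 2 ∈ K := by
    have := div_mem (hT 1) (hT 2)
    convert this using 1
    simp only [Matrix.cons_val]
    field_simp
  have h0 : h 0 / h 2 ∈ K := by
    have := sub_mem (div_mem (hT 0) (hT 2)) (pow_mem h1 2)
    convert this using 1
    simp only [Matrix.cons_val]
    field_simp
    ring
  -- Next invert `B` on `(z₀, z₁, 1)/h₂`; the last entry recovers `h₂` itself, which clears the
  -- denominators of the others.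
  have hz : ∀ i, (![coord 0 / h 2, coord 1 / h 2, 1 / h 2] : Fin 3 → RatFun 2) i ∈ K := by
    refine mem_of_sum_mem K B _ fun i => ?_
    have e : ∑ j, algebraMap ℂ (RatFun 2) (B.val i j) *
        (![coord 0 / h 2, coord 1 / h 2, 1 / h 2] : Fin 3 → RatFun 2) j = h i / h 2 := by
      rw [show coord (n := 2) 0 = g (X 0) from rfl, show coord (n := 2) 1 = g (X 1) from rfl]
      simp only [Fin.sum_univ_three, Matrix.cons_val, hh, dehom_linTriple, map_add, map_mul, hgC]
      ring
    rw [e]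
    fin_cases i
    · exact h0
    · exact h1
    · simp [hh2]
  have h2 : h 2 ∈ K := by
    have := inv_mem (hz 2)
    simpa using this
  intro i
  fin_cases i
  · have := mul_mem (hz 0) h2
    simpa [hh2] using this
  · have := mul_mem (hz 1) h2
    simpa [hh2] using this

lemma gTauH_mem_QuadBirEta {A B : GL (Fin 3) ℂ} (h : UpsilonEq A.val B.val) :
    gTauH A B ∈ QuadBirEta :=
  ⟨⟨isBirational_gTauH A B, wedge_gTauH h⟩, _, isGivenBy_gTauH A B⟩

/-! ### Quadratic maps whose Jacobian is the cube of a linear form -/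

/-- A triple of functions on `ℂ³` of the form `𝔤 τ 𝔥`. -/
def IsGTH (Q : Fin 3 → (Fin 3 → ℂ) → ℂ) : Prop :=
  ∃ A B : GL (Fin 3) ℂ, ∀ i v, Q i v = eval v (gthTriple A.val B.val i)

lemma eval_gthTriple (A B : Matrix (Fin 3) (Fin 3) ℂ) (i : Fin 3) (v : Fin 3 → ℂ) :
    eval v (gthTriple A B i) =
      A i 0 * (B.mulVec v 0 * B.mulVec v 2 + B.mulVec v 1 ^ 2) +
        A i 1 * (B.mulVec v 1 * B.mulVec v 2) + A i 2 * B.mulVec v 2 ^ 2 := by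
  simp only [gthTriple_apply, map_add, map_mul, map_pow, eval_C, eval_linTriple]

lemma isGTH_of_det_ne_zero {Q : Fin 3 → (Fin 3 → ℂ) → ℂ} (A B : Matrix (Fin 3) (Fin 3) ℂ)
    (hA : A.det ≠ 0) (hB : B.det ≠ 0)
    (h : ∀ i v, Q i v = A i 0 * (B.mulVec v 0 * B.mulVec v 2 + B.mulVec v 1 ^ 2) +
        A i 1 * (B.mulVec v 1 * B.mulVec v 2) + A i 2 * B.mulVec v 2 ^ 2) : IsGTH Q :=
  ⟨.mkOfDetNeZero A hA, .mkOfDetNeZero B hB, fun i v => by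
    rw [eval_gthTriple, h]
    rfl⟩

lemma IsGTH.comp_mulVec {Q : Fin 3 → (Fin 3 → ℂ) → ℂ} (h : IsGTH Q) (M : GL (Fin 3) ℂ) :
    IsGTH fun i v => Q i (M.val.mulVec v) := by
  obtain ⟨A, B, h⟩ := h
  refine ⟨A, B * M, fun i v => ?_⟩
  simp only [h, eval_gthTriple, Units.val_mul, Matrix.mulVec_mulVec]

lemma IsGTH.of_linear {Q : Fin 3 → (Fin 3 → ℂ) → ℂ} (N : Matrix (Fin 3) (Fin 3) ℂ)
    (hN : N.det ≠ 0) (Q' : Fin 3 → (Fin 3 → ℂ) → ℂ) (h : IsGTH Q')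
    (hQ : ∀ i v, Q i v = ∑ j, N i j * Q' j v) : IsGTH Q := by
  obtain ⟨A, B, h⟩ := h
  refine ⟨.mkOfDetNeZero N hN * A, B, fun i v => ?_⟩
  simp only [hQ, h, eval_gthTriple, Units.val_mul, Matrix.mul_apply, Fin.sum_univ_three]
  change N i 0 * _ + _ + _ = (N i 0 * _ + N i 1 * _ + N i 2 * _) * _ +
    (N i 0 * _ + N i 1 * _ + N i 2 * _) * _ + (N i 0 * _ + N i 1 * _ + N i 2 * _) * _
  ring

lemma isGTH_parallel_of_eq_zero (a b g d e h d' e' h' γ : ℂ) (hγ : γ ≠ 0)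
    (H : ∀ x y z : ℂ, z * ((2 * a * x + g * y + d * z) * (e' * z) -
      (2 * b * y + g * x + e * z) * (d' * z)) = γ ^ 2 * z ^ 3)
    (hcf : ¬ (a = 0 ∧ b = 0 ∧ g = 0)) :
    IsGTH ![fun v => a * v 0 ^ 2 + b * v 1 ^ 2 + g * (v 0 * v 1) + d * (v 0 * v 2) +
        e * (v 1 * v 2) + h * v 2 ^ 2,
      fun v => d' * (v 0 * v 2) + e' * (v 1 * v 2) + h' * v 2 ^ 2, fun v => γ * v 2 ^ 2] := by
  have h1 : 2 * a * e' = g * d' := by linear_combination H 1 0 1 - H 0 0 1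
  have h2 : g * e' = 2 * b * d' := by linear_combination H 0 1 1 - H 0 0 1
  have h3 : d * e' - e * d' = γ ^ 2 := by linear_combination H 0 0 1
  -- By `h1` and `h2` the binary form `a x² + g xy + b y²` has its gradient parallel to the nonzero
  -- vector `(d', e')` everywhere, so it is a multiple of `(d' x + e' y)²`. That linear form becomes
  -- `h₁`, with `h₂ = z`.
  have hk : ∃ k, a = k * d' ^ 2 ∧ g = 2 * k * d' * e' ∧ b = k * e' ^ 2 := by
    by_cases hd : d' = 0
    · have he : e' ≠ 0 := by
        rintro rfl
        rw [hd] at h3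
        simp at h3
        exact hγ (by simpa using h3.symm)
      refine ⟨b / e' ^ 2, ?_, ?_, by field_simp⟩
      · simpa [hd, he] using h1
      · simpa [hd, he] using h2
    · refine ⟨a / d' ^ 2, by field_simp, ?_, ?_⟩
      · field_simp
        linear_combination -h1
      · field_simp
        linear_combination (-d' / 2) * h2 - (e' / 2) * h1
  obtain ⟨k, rfl, rfl, rfl⟩ := hk
  have hk : k ≠ 0 := by
    rintro rfl
    simp at hcf
  refine isGTH_of_det_ne_zero !![k, 0, 0; 0, 1, h'; 0, 0, γ]
    !![d / k, e / k, h / k; d', e', 0; 0, 0, 1] ?_ ?_ fun i v => ?_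
  · simp [Matrix.det_fin_three, hk, hγ]
  · have : Matrix.det !![d / k, e / k, h / k; d', e', 0; 0, 0, 1] = γ ^ 2 / k := by
      rw [← h3]
      simp [Matrix.det_fin_three]
      ring
    rw [this]
    positivity
  · fin_cases i <;> simp [Matrix.mulVec, dotProduct, Fin.sum_univ_three]
    · field_simp
      ring
    · ring

lemma exists_eq_mul_of_minors_eq_zero {k : Type*} [Field k] {a b g a' b' g' : k}
    (h1 : a * b' = b * a') (h2 : a * g' = g * a') (h3 : b * g' = g * b')
    (h : ¬ (a' = 0 ∧ b' = 0 ∧ g' = 0)) : ∃ k, a = k * a' ∧ b = k * b' ∧ g = k * g' := by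
  by_cases ha : a' = 0
  · by_cases hb : b' = 0
    · have hg : g' ≠ 0 := by tauto
      refine ⟨g / g', ?_, ?_, ?_⟩ <;> field_simp
      · exact h2
      · exact h3
    · refine ⟨b / b', ?_, ?_, ?_⟩ <;> field_simp
      · exact h1
      · exact h3.symm
  · refine ⟨a / a', ?_, ?_, ?_⟩ <;> field_simp
    · exact h1.symm
    · exact h2.symm

/-- On the line `z = 0` the first two forms have vanishing Jacobian, hence are proportional there.
Subtracting a multiple of one from the other makes the latter divisible by `z`. -/
lemma isGTH_parallel (a b g d e h a' b' g' d' e' h' γ : ℂ) (hγ : γ ≠ 0)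
    (H : ∀ x y z : ℂ, z * ((2 * a * x + g * y + d * z) * (2 * b' * y + g' * x + e' * z) -
      (2 * b * y + g * x + e * z) * (2 * a' * x + g' * y + d' * z)) = γ ^ 2 * z ^ 3)
    (hcf : ¬ (a = 0 ∧ b = 0 ∧ g = 0 ∧ a' = 0 ∧ b' = 0 ∧ g' = 0)) :
    IsGTH ![fun v => a * v 0 ^ 2 + b * v 1 ^ 2 + g * (v 0 * v 1) + d * (v 0 * v 2) +
        e * (v 1 * v 2) + h * v 2 ^ 2,
      fun v => a' * v 0 ^ 2 + b' * v 1 ^ 2 + g' * (v 0 * v 1) + d' * (v 0 * v 2) +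
        e' * (v 1 * v 2) + h' * v 2 ^ 2, fun v => γ * v 2 ^ 2] := by
  by_cases hz : a' = 0 ∧ b' = 0 ∧ g' = 0
  · obtain ⟨rfl, rfl, rfl⟩ := hz
    simpa using isGTH_parallel_of_eq_zero a b g d e h d' e' h' γ hγ (by simpa using H)
      (by simpa using hcf)
  -- Finite differences at `z = 1` isolate the coefficients of `x²`, `y²` and `xy`.
  have h1 : a * g' = g * a' := by
    linear_combination (1 / 4) * (H 1 0 1 + H (-1) 0 1 - 2 * H 0 0 1)
  have h2 : g * b' = b * g' := by
    linear_combination (1 / 4) * (H 0 1 1 + H 0 (-1) 1 - 2 * H 0 0 1)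
  have h3 : a * b' = b * a' := by
    linear_combination (1 / 4) * (H 1 1 1 + H 0 0 1 - H 1 0 1 - H 0 1 1)
  obtain ⟨k, rfl, rfl, rfl⟩ := exists_eq_mul_of_minors_eq_zero h3 h1 h2.symm hz
  refine IsGTH.of_linear !![k, -1, 0; 1, 0, 0; 0, 0, 1] (by simp [Matrix.det_fin_three]) _
    (isGTH_parallel_of_eq_zero a' b' g' d' e' h' (k * d' - d) (k * e' - e) (k * h' - h) γ hγ
      (fun x y z => ?_) (by tauto)) fun i v => ?_
  · linear_combination H x y z
  · fin_cases i <;> simp [Fin.sum_univ_three]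
    ring

/-- The coordinates here have `ℓ = x` and `z₂ = y`. Comparing coefficients kills `e'`, `g` and `c`,
leaving `b y² + x (a x + d y + e w)`, `x (a' x + d' y)` and `x y`, which is `τ` with `h₂ = x` and
`h₁ = y` up to a linear map of the target. -/
lemma isGTH_transverse_of_eq_zero (a b c d e g a' d' e' K : ℂ) (hK : K ≠ 0)
    (H : ∀ x y w : ℂ, y * ((2 * b * y + g * w + d * x) * (e' * x) -
      (2 * c * w + g * y + e * x) * (d' * x)) -
      x * ((2 * a * x + d * y + e * w) * (e' * x) -
        (2 * c * w + g * y + e * x) * (2 * a' * x + d' * y + e' * w)) = K * x ^ 3)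
    (hcf : ¬ (b = 0 ∧ c = 0 ∧ g = 0)) :
    IsGTH ![fun v => a * v 0 ^ 2 + b * v 1 ^ 2 + c * v 2 ^ 2 + d * (v 0 * v 1) +
        e * (v 0 * v 2) + g * (v 1 * v 2),
      fun v => a' * v 0 ^ 2 + d' * (v 0 * v 1) + e' * (v 0 * v 2), fun v => v 0 * v 1] := by
  have hy : b * e' = 0 := by
    linear_combination (1 / 4) * (H 1 1 0 + H 1 (-1) 0 - 2 * H 1 0 0)
  have hw : c * e' = 0 := by
    linear_combination (1 / 4) * (H 1 0 1 + H 1 0 (-1) - 2 * H 1 0 0)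
  have hyw : g * e' = 0 := by
    linear_combination (1 / 2) * (H 1 1 1 + H 1 0 0 - H 1 1 0 - H 1 0 1)
  have he' : e' = 0 := by
    by_contra he
    simp only [he, mul_eq_zero, or_false] at hy hw hyw
    exact hcf ⟨hy, hw, hyw⟩
  subst he'
  have h1 : 2 * a' * e = K := by linear_combination H 1 0 0
  have h2 : a' * g = 0 := by linear_combination (1 / 2) * (H 1 1 0 - H 1 0 0)
  have h3 : a' * c = 0 := by linear_combination (1 / 4) * (H 1 0 1 - H 1 0 0)
  have ha : a' ≠ 0 := by
    rintro rfl
    apply hK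
    rw [← h1]
    ring
  have he : e ≠ 0 := by
    rintro rfl
    apply hK
    rw [← h1]
    ring
  simp only [ha, mul_eq_zero, false_or] at h2 h3
  subst h2 h3
  have hb : b ≠ 0 := by
    rintro rfl
    simp at hcf
  refine isGTH_of_det_ne_zero !![b, 0, 0; 0, d', a'; 0, 1, 0]
    !![a / b, d / b, e / b; 0, 1, 0; 1, 0, 0] ?_ ?_ fun i v => ?_
  · simp [Matrix.det_fin_three, ha, hb]
  · simp [Matrix.det_fin_three, hb, he]
  · fin_cases i <;> simp [Matrix.mulVec, dotProduct, Fin.sum_univ_three]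
    · field_simp
      ring
    · ring
    · ring

/-- As in the parallel case, with the line `x = 0`: the restrictions of the first two forms to it
are proportional. -/
lemma isGTH_transverse (a b c d e g a' b' c' d' e' g' K : ℂ) (hK : K ≠ 0)
    (H : ∀ x y w : ℂ, y * ((2 * b * y + g * w + d * x) * (2 * c' * w + g' * y + e' * x) -
      (2 * c * w + g * y + e * x) * (2 * b' * y + g' * w + d' * x)) -
      x * ((2 * a * x + d * y + e * w) * (2 * c' * w + g' * y + e' * x) -
        (2 * c * w + g * y + e * x) * (2 * a' * x + d' * y + e' * w)) = K * x ^ 3)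
    (hcf : ¬ (b = 0 ∧ c = 0 ∧ g = 0 ∧ b' = 0 ∧ c' = 0 ∧ g' = 0)) :
    IsGTH ![fun v => a * v 0 ^ 2 + b * v 1 ^ 2 + c * v 2 ^ 2 + d * (v 0 * v 1) +
        e * (v 0 * v 2) + g * (v 1 * v 2),
      fun v => a' * v 0 ^ 2 + b' * v 1 ^ 2 + c' * v 2 ^ 2 + d' * (v 0 * v 1) +
        e' * (v 0 * v 2) + g' * (v 1 * v 2), fun v => v 0 * v 1] := by
  by_cases hz : b' = 0 ∧ c' = 0 ∧ g' = 0
  · obtain ⟨rfl, rfl, rfl⟩ := hz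
    simpa using isGTH_transverse_of_eq_zero a b c d e g a' d' e' K hK (by simpa using H)
      (by simpa using hcf)
  have h1 : b * g' = g * b' := by
    linear_combination (1 / 2) * H 0 1 0
  have h2 : g * c' = c * g' := by
    linear_combination (1 / 4) * (H 0 1 1 + H 0 1 (-1) - 2 * H 0 1 0)
  have h3 : b * c' = c * b' := by
    linear_combination (1 / 8) * (H 0 1 1 - H 0 1 (-1))
  obtain ⟨k, rfl, rfl, rfl⟩ := exists_eq_mul_of_minors_eq_zero h3 h1 h2.symm hz
  refine IsGTH.of_linear !![k, -1, 0; 1, 0, 0; 0, 0, 1] (by simp [Matrix.det_fin_three]) _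
    (isGTH_transverse_of_eq_zero a' b' c' d' e' g' (k * a' - a) (k * d' - d) (k * e' - e) K hK
      (fun x y w => ?_) (by tauto)) fun i v => ?_
  · linear_combination H x y w
  · fin_cases i <;> simp [Fin.sum_univ_three]
    ring

/-! ### From the Jacobian equation to the two normal forms -/

/-- The quadratic form with matrix `S`. -/
def quadForm (S : Matrix (Fin 3) (Fin 3) ℂ) (v : Fin 3 → ℂ) : ℂ := v ⬝ᵥ S.mulVec v

/-- The matrix whose rows are half the gradients of the quadratic forms with matrices `S i`. -/
def gradMatrix (S : Fin 3 → Matrix (Fin 3) (Fin 3) ℂ) (v : Fin 3 → ℂ) :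
    Matrix (Fin 3) (Fin 3) ℂ := Matrix.of fun i => (S i).mulVec v

lemma quadForm_apply (S : Matrix (Fin 3) (Fin 3) ℂ) (hS : S.IsSymm) (v : Fin 3 → ℂ) :
    quadForm S v = S 0 0 * v 0 ^ 2 + S 1 1 * v 1 ^ 2 + 2 * S 0 1 * (v 0 * v 1) +
      2 * S 0 2 * (v 0 * v 2) + 2 * S 1 2 * (v 1 * v 2) + S 2 2 * v 2 ^ 2 := by
  have h := hS.apply
  simp only [quadForm, Matrix.mulVec, dotProduct, Fin.sum_univ_three, h 0 1, h 0 2, h 1 2]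
  ring

/-- The second derivatives of a quadratic form are constants, and Euler's identity applied twice
recovers the form from them. -/
lemma exists_quadForm {f : MvPolynomial (Fin 3) ℂ} (hf : f.IsHomogeneous 2) :
    ∃ S : Matrix (Fin 3) (Fin 3) ℂ, S.IsSymm ∧ ∀ v, eval v f = quadForm S v := by
  have h2 : ∀ i j, ∃ c, pderiv j (pderiv i f) = C c := fun i j => by
    have h : (pderiv j (pderiv i f)).IsHomogeneous 0 := hf.pderiv.pderiv
    exact ⟨_, (totalDegree_eq_zero_iff_eq_C.1 (by simpa using h.totalDegree_le))⟩
  choose T hT using h2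
  have hf2 : 2 * f = ∑ i, X i * ∑ j, X j * C (T i j) := by
    have h1 : ∀ i, pderiv i f = ∑ j, X j * C (T i j) := fun i => by
      have := (hf.pderiv (i := i)).sum_X_mul_pderiv
      simp only [hT] at this
      simpa using this.symm
    have := hf.sum_X_mul_pderiv
    simp only [h1] at this
    rw [this]
    simp [two_mul]
  refine ⟨Matrix.of fun i j => (T i j + T j i) / 4, ?_, fun v => ?_⟩
  · ext i j
    simp [add_comm]
  · have := congrArg (eval v) hf2
    simp only [Fin.sum_univ_three, map_mul, map_add, eval_X, eval_C, map_ofNat] at this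
    simp only [quadForm, Matrix.mulVec, dotProduct, Fin.sum_univ_three, Matrix.of_apply]
    linear_combination this / 2

/-- By Euler, the row `F` is a combination of the half gradients in which `∂₂` has coefficient `1`
on the chart; the other two rows each give a factor `2`. -/
lemma eval_jac_dehom {f : Fin 3 → MvPolynomial (Fin 3) ℂ}
    {S : Fin 3 → Matrix (Fin 3) (Fin 3) ℂ} (hS : ∀ i, (S i).IsSymm)
    (h : ∀ i v, eval v (f i) = quadForm (S i) v) (v : Fin 2 → ℂ) :
    eval v (jac fun i => dehom (f i)) = 4 * (gradMatrix S ![v 0, v 1, 1]).det := by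
  have hd : ∀ i, dehom (f i) = C (S i 0 0) * X 0 ^ 2 + C (S i 1 1) * X 1 ^ 2 +
      C (2 * S i 0 1) * (X 0 * X 1) + C (2 * S i 0 2) * X 0 + C (2 * S i 1 2) * X 1 +
      C (S i 2 2) := fun i => by
    apply MvPolynomial.funext
    intro v
    rw [eval_dehom, h, quadForm_apply _ (hS i)]
    simp
  have h0 : ∀ i, pderiv 0 (dehom (f i)) = 2 * C (S i 0 0) * X 0 + C (2 * S i 0 1) * X 1 +
      C (2 * S i 0 2) := fun i => by
    rw [hd]
    simp [Derivation.leibniz_pow]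
    ring
  have h1 : ∀ i, pderiv 1 (dehom (f i)) = 2 * C (S i 1 1) * X 1 + C (2 * S i 0 1) * X 0 +
      C (2 * S i 1 2) := fun i => by
    rw [hd]
    simp [Derivation.leibniz_pow]
    ring
  have e0 : ∀ i, S i 1 0 = S i 0 1 := fun i => (hS i).apply 0 1
  have e1 : ∀ i, S i 2 0 = S i 0 2 := fun i => (hS i).apply 0 2
  have e2 : ∀ i, S i 2 1 = S i 1 2 := fun i => (hS i).apply 1 2
  have g : ∀ i, eval v (dehom (f i)) = v 0 * (gradMatrix S ![v 0, v 1, 1] i 0) +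
      v 1 * (gradMatrix S ![v 0, v 1, 1] i 1) + gradMatrix S ![v 0, v 1, 1] i 2 := fun i => by
    rw [hd]
    simp [gradMatrix, Matrix.mulVec, dotProduct, Fin.sum_univ_three, e0, e1, e2]
    ring
  have g0 : ∀ i, eval v (pderiv 0 (dehom (f i))) = 2 * gradMatrix S ![v 0, v 1, 1] i 0 :=
    fun i => by
      rw [h0]
      simp [gradMatrix, Matrix.mulVec, dotProduct, Fin.sum_univ_three]
      ring
  have g1 : ∀ i, eval v (pderiv 1 (dehom (f i))) = 2 * gradMatrix S ![v 0, v 1, 1] i 1 :=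
    fun i => by
      rw [h1]
      simp [gradMatrix, Matrix.mulVec, dotProduct, Fin.sum_univ_three, e0]
      ring
  simp only [jac, Matrix.det_fin_three, Matrix.of_apply, Matrix.cons_val, map_add, map_sub,
    map_mul, g, g0, g1]
  ring

/-- Degree count along the line `s ↦ (s x, s y, 1)`: the determinant has degree at most `3` in `s`,
while the right side has leading term `f₂(x, y, 0)³ s⁶`. -/
lemma quadForm_eq_zero_of_det {S : Fin 3 → Matrix (Fin 3) (Fin 3) ℂ} (hS : ∀ i, (S i).IsSymm)
    (H : ∀ x y, 4 * (gradMatrix S ![x, y, 1]).det = quadForm (S 2) ![x, y, 1] ^ 3) (x y : ℂ) :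
    quadForm (S 2) ![x, y, 0] = 0 := by
  by_contra ha
  set P := gradMatrix S ![x, y, 0]
  set E := gradMatrix S ![0, 0, 1]
  set a := quadForm (S 2) ![x, y, 0]
  set b := 2 * S 2 0 2 * x + 2 * S 2 1 2 * y
  set c := S 2 2 2
  have key : Polynomial.C 4 * Matrix.det ((Polynomial.X : Polynomial ℂ) • P.map Polynomial.C +
      E.map Polynomial.C) =
      (Polynomial.C a * Polynomial.X ^ 2 + Polynomial.C b * Polynomial.X + Polynomial.C c) ^ 3 := by
    apply Polynomial.funext
    intro s
    have h1 : Polynomial.eval s (Matrix.det ((Polynomial.X : Polynomial ℂ) • P.map Polynomial.C +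
        E.map Polynomial.C)) = (gradMatrix S ![s * x, s * y, 1]).det := by
      rw [← Polynomial.coe_evalRingHom, RingHom.map_det]
      congr 1
      ext i j
      simp [P, E, gradMatrix, Matrix.mulVec, dotProduct, Fin.sum_univ_three]
      ring
    rw [Polynomial.eval_mul, h1, Polynomial.eval_C, H]
    simp [a, b, c, quadForm_apply _ (hS 2)]
    ring
  have h6 := congrArg Polynomial.natDegree key
  rw [Polynomial.natDegree_pow, Polynomial.natDegree_quadratic ha,
    Polynomial.natDegree_C_mul (by norm_num)] at h6
  have := Polynomial.natDegree_det_X_add_C_le P E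
  simp at this
  omega

lemma gradMatrix_smul (S : Fin 3 → Matrix (Fin 3) (Fin 3) ℂ) (c : ℂ) (v : Fin 3 → ℂ) :
    gradMatrix S (c • v) = c • gradMatrix S v := by
  ext i j
  simp [gradMatrix, Matrix.mulVec_smul]

lemma det_gradMatrix_eq {S : Fin 3 → Matrix (Fin 3) (Fin 3) ℂ}
    (h0 : ∀ v : Fin 3 → ℂ, quadForm (S 2) v =
      v 2 * (2 * S 2 0 2 * v 0 + 2 * S 2 1 2 * v 1 + S 2 2 2 * v 2))
    (H : ∀ x y, 4 * (gradMatrix S ![x, y, 1]).det = quadForm (S 2) ![x, y, 1] ^ 3)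
    (v : Fin 3 → ℂ) :
    4 * (gradMatrix S v).det = (2 * S 2 0 2 * v 0 + 2 * S 2 1 2 * v 1 + S 2 2 2 * v 2) ^ 3 := by
  have h1 : ∀ z : ℂ, z ≠ 0 → 4 * (gradMatrix S ![v 0, v 1, z]).det =
      (2 * S 2 0 2 * v 0 + 2 * S 2 1 2 * v 1 + S 2 2 2 * z) ^ 3 := fun z hz => by
    have e : ![v 0, v 1, z] = z • ![v 0 / z, v 1 / z, 1] := by
      ext i
      fin_cases i <;> simp <;> field_simp
    have := H (v 0 / z) (v 1 / z)
    rw [h0] at this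
    simp only [Matrix.cons_val] at this
    rw [e, gradMatrix_smul, Matrix.det_smul, Fintype.card_fin]
    have h2 : 2 * S 2 0 2 * v 0 + 2 * S 2 1 2 * v 1 + S 2 2 2 * z =
        z * (2 * S 2 0 2 * (v 0 / z) + 2 * S 2 1 2 * (v 1 / z) + S 2 2 2) := by
      field_simp
    rw [h2]
    linear_combination z ^ 3 * this
  -- The factor `z₂³` can be cancelled only where `z₂ ≠ 0`; continuity covers the rest.
  have h3 : (fun z : ℂ => 4 * (gradMatrix S ![v 0, v 1, z]).det) =
      fun z => (2 * S 2 0 2 * v 0 + 2 * S 2 1 2 * v 1 + S 2 2 2 * z) ^ 3 := by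
    refine Continuous.ext_on (dense_compl_singleton (0 : ℂ)) ?_ (by fun_prop) h1
    simp only [Matrix.det_fin_three, gradMatrix, Matrix.of_apply, Matrix.mulVec, dotProduct,
      Fin.sum_univ_three, Matrix.cons_val]
    fun_prop
  have e : v = ![v 0, v 1, v 2] := by
    ext i
    fin_cases i <;> rfl
  rw [e]
  exact congrFun h3 (v 2)

lemma not_isUnit_of_eval_zero {p : MvPolynomial (Fin 3) ℂ} (hp : eval 0 p = 0) : ¬ IsUnit p :=
  fun h => (h.map (eval (0 : Fin 3 → ℂ))).ne_zero hp

lemma isGTH_of_jac_parallel {f : Fin 3 → MvPolynomial (Fin 3) ℂ}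
    {S : Fin 3 → Matrix (Fin 3) (Fin 3) ℂ} (hS : ∀ i, (S i).IsSymm)
    (hf : ∀ i v, eval v (f i) = quadForm (S i) v)
    (hcf : ∀ p, (∀ i, p ∣ f i) → IsUnit p) {γ : ℂ} (hγ : γ ≠ 0)
    (h2 : ∀ v, quadForm (S 2) v = γ * v 2 ^ 2)
    (hS2 : S 2 = !![0, 0, 0; 0, 0, 0; 0, 0, γ])
    (H : ∀ v, 4 * (gradMatrix S v).det = (γ * v 2) ^ 3) :
    IsGTH fun i v => eval v (f i) := by
  have e0 : ∀ i, S i 1 0 = S i 0 1 := fun i => (hS i).apply 0 1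
  have e1 : ∀ i, S i 2 0 = S i 0 2 := fun i => (hS i).apply 0 2
  have e2 : ∀ i, S i 2 1 = S i 1 2 := fun i => (hS i).apply 1 2
  convert isGTH_parallel (S 0 0 0) (S 0 1 1) (2 * S 0 0 1) (2 * S 0 0 2) (2 * S 0 1 2) (S 0 2 2)
    (S 1 0 0) (S 1 1 1) (2 * S 1 0 1) (2 * S 1 0 2) (2 * S 1 1 2) (S 1 2 2) γ hγ ?_ ?_ using 1
  · ext i v
    fin_cases i
    · simp [hf, quadForm_apply _ (hS 0)]
    · simp [hf, quadForm_apply _ (hS 1)]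
    · simp [hf, h2]
  · intro x y z
    have := H ![x, y, z]
    simp [Matrix.det_fin_three, gradMatrix, Matrix.mulVec, dotProduct, Fin.sum_univ_three, e0, e1,
      e2, hS2] at this
    apply mul_left_cancel₀ hγ
    linear_combination this
  -- In this degenerate case `z₂` would divide all three forms.
  · rintro ⟨h00, h11, h01, h00', h11', h01'⟩
    refine not_isUnit_of_eval_zero (p := X 2) (by simp) (hcf _ fun i => ?_)
    have : ∃ a b c, ∀ v, quadForm (S i) v = v 2 * (a * v 0 + b * v 1 + c * v 2) := by
      refine ⟨2 * S i 0 2, 2 * S i 1 2, S i 2 2, fun v => ?_⟩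
      fin_cases i
      · rw [quadForm_apply _ (hS _)]
        simp only [Fin.zero_eta]
        linear_combination v 0 ^ 2 * h00 + v 1 ^ 2 * h11 + v 0 * v 1 * h01
      · rw [quadForm_apply _ (hS _)]
        simp only [Fin.mk_one]
        linear_combination v 0 ^ 2 * h00' + v 1 ^ 2 * h11' + v 0 * v 1 * h01'
      · simp only [Fin.reduceFinMk, h2]
        simp [hS2]
        ring
    obtain ⟨a, b, c, h⟩ := this
    refine ⟨C a * X 0 + C b * X 1 + C c * X 2, MvPolynomial.funext fun v => ?_⟩
    simp [hf, h]

lemma isGTH_of_jac_transverse {f : Fin 3 → MvPolynomial (Fin 3) ℂ}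
    {S : Fin 3 → Matrix (Fin 3) (Fin 3) ℂ} (hS : ∀ i, (S i).IsSymm)
    (hf : ∀ i v, eval v (f i) = quadForm (S i) v)
    (hcf : ∀ p, (∀ i, p ∣ f i) → IsUnit p) {α β γ : ℂ} (hαβ : ¬ (α = 0 ∧ β = 0))
    (h2 : ∀ v, quadForm (S 2) v = v 2 * (α * v 0 + β * v 1 + γ * v 2))
    (H : ∀ v, 4 * (gradMatrix S v).det = (α * v 0 + β * v 1 + γ * v 2) ^ 3) :
    IsGTH fun i v => eval v (f i) := by
  -- A third linear form completing `ℓ` and `z₂` to a coordinate system.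
  obtain ⟨w0, w1, hw⟩ : ∃ w0 w1, β * w0 - α * w1 ≠ 0 := by
    by_cases h : α = 0
    · exact ⟨1, 0, by simp; tauto⟩
    · exact ⟨0, 1, by simpa using h⟩
  set M : GL (Fin 3) ℂ := .mkOfDetNeZero !![α, β, γ; 0, 0, 1; w0, w1, 0]
    (by
      convert hw using 1
      simp [Matrix.det_fin_three]
      ring) with hM
  have hMv : M.val = !![α, β, γ; 0, 0, 1; w0, w1, 0] := rfl
  set N := M⁻¹.val with hN
  have hMN : M.val * N = 1 := by rw [hN, ← Units.val_mul, mul_inv_cancel, Units.val_one]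
  have hNM : N * M.val = 1 := by rw [hN, ← Units.val_mul, inv_mul_cancel, Units.val_one]
  set S' : Fin 3 → Matrix (Fin 3) (Fin 3) ℂ := fun i => N.transpose * S i * N with hS'def
  have hS' : ∀ i, (S' i).IsSymm := fun i => by
    simp only [hS'def, Matrix.IsSymm, Matrix.transpose_mul, Matrix.transpose_transpose, (hS i).eq,
      Matrix.mul_assoc]
  have hq : ∀ i v, quadForm (S' i) v = quadForm (S i) (N.mulVec v) := fun i v => by
    simp only [quadForm, hS'def, ← Matrix.mulVec_mulVec, Matrix.mulVec_transpose]
    rw [dotProduct_comm, ← Matrix.dotProduct_mulVec, dotProduct_comm]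
  have hl : ∀ v, α * N.mulVec v 0 + β * N.mulVec v 1 + γ * N.mulVec v 2 = v 0 := fun v => by
    have := congrFun (congrArg (fun A => A.mulVec v) hMN) 0
    simp only [← Matrix.mulVec_mulVec, hMv, Matrix.one_mulVec] at this
    rw [← this]
    simp [Matrix.mulVec, dotProduct, Fin.sum_univ_three]
  have hz : ∀ v, N.mulVec v 2 = v 1 := fun v => by
    have := congrFun (congrArg (fun A => A.mulVec v) hMN) 1
    simp only [← Matrix.mulVec_mulVec, hMv, Matrix.one_mulVec] at this
    rw [← this]
    simp [Matrix.mulVec, dotProduct, Fin.sum_univ_three]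
  have h2' : ∀ v, quadForm (S' 2) v = v 0 * v 1 := fun v => by
    rw [hq, h2, hl, hz, mul_comm]
  -- The `8` converts half gradients into gradients, matching the Jacobian in `isGTH_transverse`.
  have H' : ∀ v, 8 * (gradMatrix S' v).det = 2 * N.det * v 0 ^ 3 := fun v => by
    have : gradMatrix S' v = gradMatrix S (N.mulVec v) * N := by
      ext i j
      change (S' i).mulVec v j = Matrix.vecMul ((S i).mulVec (N.mulVec v)) N j
      simp only [hS'def, ← Matrix.mulVec_mulVec, Matrix.mulVec_transpose]
    rw [this, Matrix.det_mul]
    linear_combination 2 * N.det * H (N.mulVec v) + 2 * N.det * congrArg (· ^ 3) (hl v)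
  have hK : 2 * N.det ≠ 0 := by
    have := congrArg Matrix.det hMN
    rw [Matrix.det_mul, Matrix.det_one] at this
    exact mul_ne_zero two_ne_zero (right_ne_zero_of_mul_eq_one this)
  have e0 : ∀ i, S' i 1 0 = S' i 0 1 := fun i => (hS' i).apply 0 1
  have e1 : ∀ i, S' i 2 0 = S' i 0 2 := fun i => (hS' i).apply 0 2
  have e2 : ∀ i, S' i 2 1 = S' i 1 2 := fun i => (hS' i).apply 1 2
  have h2q := fun v => (quadForm_apply _ (hS' 2) v).symm.trans (h2' v)
  have s00 : S' 2 0 0 = 0 := by simpa using h2q ![1, 0, 0]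
  have s11 : S' 2 1 1 = 0 := by simpa using h2q ![0, 1, 0]
  have s22 : S' 2 2 2 = 0 := by simpa using h2q ![0, 0, 1]
  have s01 : S' 2 0 1 = 1 / 2 := by
    linear_combination (by simpa [s00, s11] using h2q ![1, 1, 0] : 2 * S' 2 0 1 = 1) / 2
  have s02 : S' 2 0 2 = 0 := by simpa [s00, s22] using h2q ![1, 0, 1]
  have s12 : S' 2 1 2 = 0 := by simpa [s11, s22] using h2q ![0, 1, 1]
  have main := isGTH_transverse (S' 0 0 0) (S' 0 1 1) (S' 0 2 2) (2 * S' 0 0 1) (2 * S' 0 0 2)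
    (2 * S' 0 1 2) (S' 1 0 0) (S' 1 1 1) (S' 1 2 2) (2 * S' 1 0 1) (2 * S' 1 0 2)
    (2 * S' 1 1 2) (2 * N.det) hK ?_ ?_
  · convert main.comp_mulVec M using 1
    ext i v
    have hv : quadForm (S i) v = quadForm (S' i) (M.val.mulVec v) := by
      rw [hq, Matrix.mulVec_mulVec, hNM, Matrix.one_mulVec]
    simp only [hf, hv]
    fin_cases i
    · simp [quadForm_apply _ (hS' 0)]
      ring
    · simp [quadForm_apply _ (hS' 1)]
      ring
    · simp [h2']
  · intro x y w
    have := H' ![x, y, w]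
    generalize N.det = K at this ⊢
    simp [Matrix.det_fin_three, gradMatrix, Matrix.mulVec, dotProduct, Fin.sum_univ_three, e0, e1,
      e2, s00, s11, s22, s01, s02, s12] at this
    linear_combination this
  -- Here `ℓ` would be a common factor.
  · rintro ⟨h11, h22, h12, h11', h22', h12'⟩
    refine not_isUnit_of_eval_zero (p := C α * X 0 + C β * X 1 + C γ * X 2) (by simp)
      (hcf _ fun i => ?_)
    have : ∃ a b c, ∀ v, quadForm (S' i) v = v 0 * (a * v 0 + b * v 1 + c * v 2) := by
      refine ⟨S' i 0 0, 2 * S' i 0 1, 2 * S' i 0 2, fun v => ?_⟩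
      fin_cases i
      · rw [quadForm_apply _ (hS' _)]
        simp only [Fin.zero_eta]
        linear_combination v 1 ^ 2 * h11 + v 2 ^ 2 * h22 + v 1 * v 2 * h12
      · rw [quadForm_apply _ (hS' _)]
        simp only [Fin.mk_one]
        linear_combination v 1 ^ 2 * h11' + v 2 ^ 2 * h22' + v 1 * v 2 * h12'
      · simp [h2', s00, s02, s01]
    obtain ⟨a, b, c, h⟩ := this
    refine ⟨C a * (C α * X 0 + C β * X 1 + C γ * X 2) + C b * X 2 +
      C c * (C w0 * X 0 + C w1 * X 1), MvPolynomial.funext fun v => ?_⟩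
    have hv : quadForm (S i) v = quadForm (S' i) (M.val.mulVec v) := by
      rw [hq, Matrix.mulVec_mulVec, hNM, Matrix.one_mulVec]
    rw [hf, hv, h, hMv]
    simp [Matrix.mulVec, dotProduct, Fin.sum_univ_three]

lemma isGTH_of_jac {f : Fin 3 → MvPolynomial (Fin 3) ℂ} (hf : ∀ i, (f i).IsHomogeneous 2)
    (hcf : ∀ p, (∀ i, p ∣ f i) → IsUnit p) (hf2 : f 2 ≠ 0)
    (hjac : jac (fun i => dehom (f i)) = dehom (f 2) ^ 3) : IsGTH fun i v => eval v (f i) := by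
  choose S hS hfS using fun i => exists_quadForm (hf i)
  have H : ∀ x y, 4 * (gradMatrix S ![x, y, 1]).det = quadForm (S 2) ![x, y, 1] ^ 3 := fun x y => by
    have := congrArg (eval ![x, y]) hjac
    rw [eval_jac_dehom hS hfS, map_pow, eval_dehom, hfS] at this
    exact this
  have h0 := quadForm_eq_zero_of_det hS H
  have s00 : S 2 0 0 = 0 := by simpa [quadForm_apply _ (hS 2)] using h0 1 0
  have s11 : S 2 1 1 = 0 := by simpa [quadForm_apply _ (hS 2)] using h0 0 1
  have s01 : S 2 0 1 = 0 := by simpa [quadForm_apply _ (hS 2), s00, s11] using h0 1 1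
  have hq : ∀ v : Fin 3 → ℂ, quadForm (S 2) v =
      v 2 * (2 * S 2 0 2 * v 0 + 2 * S 2 1 2 * v 1 + S 2 2 2 * v 2) := fun v => by
    rw [quadForm_apply _ (hS 2), s00, s11, s01]
    ring
  have hdet := det_gradMatrix_eq hq H
  by_cases hαβ : 2 * S 2 0 2 = 0 ∧ 2 * S 2 1 2 = 0
  · have s02 : S 2 0 2 = 0 := by simpa using hαβ.1
    have s12 : S 2 1 2 = 0 := by simpa using hαβ.2
    have hγ : S 2 2 2 ≠ 0 := fun h => hf2 <| MvPolynomial.funext fun v => by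
      rw [hfS, hq, s02, s12, h]
      simp
    refine isGTH_of_jac_parallel hS hfS hcf hγ (fun v => ?_) ?_ fun v => ?_
    · rw [hq, s02, s12]
      ring
    · have e0 := (hS 2).apply 0 1
      have e1 := (hS 2).apply 0 2
      have e2 := (hS 2).apply 1 2
      ext i j
      fin_cases i <;> fin_cases j <;> simp [*]
    · rw [hdet, s02, s12]
      ring
  · exact isGTH_of_jac_transverse hS hfS hcf hαβ hq hdet

/-! ### Recovering the equations of `Υ` from the map -/

/-- `p³ - q³` splits into the factors `p - q`, `p - ω q`, `p - ω² q` in a domain, for `ω` a root of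
`X² + X + 1`. -/
lemma exists_eq_C_mul_of_pow_three_eq {σ k : Type*} [Field k] [IsAlgClosed k]
    {p q : MvPolynomial σ k} (h : p ^ 3 = q ^ 3) : ∃ c : k, c ^ 3 = 1 ∧ p = C c * q := by
  obtain ⟨ω, hω⟩ := IsAlgClosed.exists_root
    (Polynomial.C 1 * Polynomial.X ^ 2 + Polynomial.C 1 * Polynomial.X + Polynomial.C (1 : k))
    (by rw [Polynomial.degree_quadratic one_ne_zero]; norm_num)
  have hω' : ω ^ 2 + ω + 1 = 0 := by simpa using hω
  have hC : (C ω : MvPolynomial σ k) ^ 2 + C ω + 1 = 0 := by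
    rw [← C_pow, ← C_add, ← C_1, ← C_add, hω', C_0]
  have hprod : (p - q) * ((p - C ω * q) * (p - C (ω ^ 2) * q)) = 0 := by
    rw [C_pow]
    linear_combination h + (p * q ^ 2 * C ω - p ^ 2 * q - (C ω - 1) * q ^ 3) * hC
  have h3 : ω ^ 3 = 1 := by linear_combination (ω - 1) * hω'
  rcases mul_eq_zero.1 hprod with h1 | h1
  · exact ⟨1, by simp, by simpa [sub_eq_zero] using h1⟩
  rcases mul_eq_zero.1 h1 with h1 | h1
  · exact ⟨ω, h3, sub_eq_zero.1 h1⟩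
  · exact ⟨ω ^ 2, by rw [← pow_mul, mul_comm, pow_mul, h3, one_pow], sub_eq_zero.1 h1⟩

lemma upsilonEq_of_jac (A B : GL (Fin 3) ℂ)
    (h : jac (fun i => dehom (gthTriple A.val B.val i)) = dehom (gthTriple A.val B.val 2) ^ 3) :
    UpsilonEq A.val B.val := by
  set f2 := gthTriple A.val B.val 2 with hf2
  obtain ⟨κ, hκ⟩ := IsAlgClosed.exists_pow_nat_eq (A.val.det * B.val.det) (n := 3) (by norm_num)
  have hX : (C κ * (linTriple B.val 2 * X 2)).IsHomogeneous 2 := by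
    simpa using (isHomogeneous_C _ κ).mul
      ((isHomogeneous_linTriple B.val 2).mul (isHomogeneous_X ℂ 2))
  have h1 : f2 ^ 3 = (C κ * (linTriple B.val 2 * X 2)) ^ 3 := by
    rw [← sub_eq_zero]
    by_contra hne
    refine dehom_ne_zero (((isHomogeneous_gthTriple _ _ 2).pow 3).sub (hX.pow 3)) hne ?_
    rw [jac_gthTriple] at h
    simp only [map_sub, map_pow, map_mul, ← hf2, ← h, ← hκ]
    simp [dehom, algebraMap_eq]
    ring
  obtain ⟨ζ, hζ, h2⟩ := exists_eq_C_mul_of_pow_three_eq h1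
  rw [hf2, gthTriple_apply] at h2
  -- At the point with `h = (0, 1, 0)` the product `h₂ z₂` vanishes and only the coefficient of
  -- `h₁²` survives.
  have h20 : A.val 2 0 = 0 := by
    obtain ⟨v, hv⟩ := exists_eval_linTriple_eq B ![0, 1, 0]
    simpa [hv] using congrArg (eval v) h2
  have h4 : C (A.val 2 1) * linTriple B.val 1 + C (A.val 2 2) * linTriple B.val 2 =
      C (ζ * κ) * X 2 := by
    apply mul_left_cancel₀ (linTriple_ne_zero B 2)
    rw [h20, C_0] at h2
    rw [C_mul]
    linear_combination h2
  have h5 : ∀ v : Fin 3 → ℂ, A.val 2 1 * B.val.mulVec v 1 + A.val 2 2 * B.val.mulVec v 2 =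
      ζ * κ * v 2 := fun v => by
    simpa only [map_add, map_mul, eval_C, eval_X, eval_linTriple] using congrArg (eval v) h4
  have e0 := h5 ![1, 0, 0]
  have e1 := h5 ![0, 1, 0]
  have e2 := h5 ![0, 0, 1]
  simp [Matrix.mulVec, dotProduct, Fin.sum_univ_three] at e0 e1 e2
  refine ⟨h20, e0, e1, ?_⟩
  rw [e2, mul_pow, hζ, hκ, one_mul]

/-- The matrices reproduce the triple `f` itself, not just the map, so that polynomial conditions on
any system of coordinates in `quadCoords` can be read on `gthTriple`. -/
lemma exists_upsilonEq_of_isGivenBy {f : Fin 3 → MvPolynomial (Fin 3) ℂ} {φ : Fin 2 → RatFun 2}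
    (hφ : φ ∈ BirEta) (hf : IsGivenBy 2 f φ) :
    ∃ A B : GL (Fin 3) ℂ, UpsilonEq A.val B.val ∧ f = gthTriple A.val B.val ∧ φ = gTauH A B := by
  obtain ⟨hhom, hcf, hne, hφf⟩ := hf
  have hne : f 2 ≠ 0 := hne
  have hw := hφ.2
  rw [hφf] at hw
  have hjac := (wedge_toAffine_iff f (dehom_ne_zero (hhom 2) hne)).1 (by exact hw)
  obtain ⟨A, B, hAB⟩ := isGTH_of_jac hhom hcf hne hjac
  have hf : f = gthTriple A.val B.val := by
    ext1 i
    apply MvPolynomial.funext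
    intro v
    exact hAB i v
  rw [hf] at hjac hφf
  exact ⟨A, B, upsilonEq_of_jac A B hjac, hf, hφf⟩

theorem mem_QuadBirEta_iff (φ : Fin 2 → RatFun 2) : φ ∈ QuadBirEta ↔
    ∃ A B : GL (Fin 3) ℂ, (toAut A, toAut B) ∈ Upsilon ∧ φ = gTauH A B := by
  constructor
  · rintro ⟨hφ, f, hf⟩
    obtain ⟨A, B, h, -, h'⟩ := exists_upsilonEq_of_isGivenBy hφ hf
    exact ⟨A, B, (mem_Upsilon_iff A B).2 h, h'⟩
  · rintro ⟨A, B, h, rfl⟩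
    exact gTauH_mem_QuadBirEta ((mem_Upsilon_iff A B).1 h)

/-! ### The obstruction to exactness -/

/-- A derivative has no simple pole along a hypersurface `x = 0` which is not invariant. -/
lemma dvd_of_mul_derivation_eq {n : ℕ} (D : Derivation ℂ (RatFun n) (RatFun n))
    (d : Derivation ℂ (MvPolynomial (Fin n) ℂ) (MvPolynomial (Fin n) ℂ))
    (hD : ∀ p, D (algebraMap _ _ p) = algebraMap _ _ (d p)) {x s : MvPolynomial (Fin n) ℂ}
    (hx : Prime x) (hdx : ¬ x ∣ d x) {ψ : RatFun n}
    (h : algebraMap _ _ x * D ψ = algebraMap _ _ s) : x ∣ s := by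
  obtain ⟨a, b, hab, rfl⟩ :=
    IsFractionRing.exists_reduced_fraction (A := MvPolynomial (Fin n) ℂ) (K := RatFun n) ψ
  have hb : (b : MvPolynomial (Fin n) ℂ) ≠ 0 := nonZeroDivisors.ne_zero b.2
  obtain ⟨b, hb'⟩ := b
  simp only at hb hab
  have hgb : algebraMap _ (RatFun n) b ≠ 0 := by simpa using hb
  have h1 : x * (b * d a - a * d b) = s * b ^ 2 := by
    apply FaithfulSMul.algebraMap_injective (MvPolynomial (Fin n) ℂ) (RatFun n)
    rw [IsFractionRing.mk'_eq_div, Derivation.leibniz_div, hD, hD] at h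
    simp only [map_mul, map_sub, map_pow, ← h, smul_eq_mul]
    field_simp
  obtain ⟨k, c, rfl, hc⟩ : ∃ k c, b = x ^ k * c ∧ ¬ x ∣ c :=
    ⟨_, (FiniteMultiplicity.of_prime_left hx hb).exists_eq_pow_mul_and_not_dvd⟩
  rcases Nat.eq_zero_or_pos k with rfl | hk
  · have h2 : x ∣ s * (x ^ 0 * c) ^ 2 := ⟨_, h1.symm⟩
    rw [pow_zero, one_mul] at h2
    exact (hx.dvd_or_dvd h2).resolve_right fun h => hc (hx.dvd_of_dvd_pow h)
  obtain ⟨k, rfl⟩ := Nat.exists_eq_succ_of_ne_zero hk.ne'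
  exfalso
  have hxa : ¬ x ∣ a := fun h =>
    hx.not_isUnit (hab h (Dvd.dvd.mul_right (dvd_pow_self x (Nat.succ_ne_zero k)) c))
  -- The denominator has order exactly `k + 1` along `x`. After division by `x ^ (k + 1)`, the only
  -- term not visibly divisible by `x` is `(k + 1) a c d x`, and `k + 1` is invertible.
  have h3 : x * (c * d a - a * d c) - C ((k + 1 : ℕ) : ℂ) * (a * c * d x) =
      s * x ^ (k + 1) * c ^ 2 := by
    apply mul_left_cancel₀ (pow_ne_zero (k + 1) hx.ne_zero)
    have hC : (C ((k + 1 : ℕ) : ℂ) : MvPolynomial (Fin n) ℂ) = (k + 1 : ℕ) := map_natCast _ _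
    rw [hC]
    simp only [Derivation.leibniz, Derivation.leibniz_pow, smul_eq_mul, nsmul_eq_mul,
      Nat.succ_eq_add_one, Nat.add_sub_cancel] at h1
    linear_combination h1
  have h4 : x ∣ C ((k + 1 : ℕ) : ℂ) * (a * c * d x) := by
    refine (dvd_sub_right (Dvd.intro _ rfl)).1 (h3.symm ▸ ?_ : x ∣ x * (c * d a - a * d c) - _)
    exact ((dvd_pow_self x (Nat.succ_ne_zero k)).mul_left s).mul_right _
  have hu : IsUnit (C ((k + 1 : ℕ) : ℂ) : MvPolynomial (Fin n) ℂ) :=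
    (IsUnit.mk0 _ (Nat.cast_ne_zero.2 (Nat.succ_ne_zero k))).map C
  rcases hx.dvd_or_dvd ((hu.dvd_mul_left).1 h4) with h5 | h5
  · exact (hx.dvd_or_dvd h5).elim hxa hc
  · exact hdx h5

lemma exists_residue {K L : Type*} [Field K] [CharZero K] [Field L] [Algebra K L]
    (D : Derivation K L L) {X T : L}
    (hX : X ≠ 0) (hDX : D X = 1) (hDT : D T = 0) (q0 q1 κ0 κ1 b0 b1 c0 c1 : K) (e F : L)
    (h : (algebraMap K L q0 * T + algebraMap K L κ0 / X + algebraMap K L b0 +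
        algebraMap K L c0 * X) *
      D (algebraMap K L q1 * T + algebraMap K L κ1 / X + algebraMap K L b1 +
        algebraMap K L c1 * X) + D F = e) :
    ∃ ψ, X * D ψ = X * (e - algebraMap K L c1 * (algebraMap K L q0 * T + algebraMap K L b0 +
      algebraMap K L c0 * X)) - algebraMap K L (κ0 * c1 - c0 * κ1) := by
  have hK : ∀ a : K, D (algebraMap K L a) = 0 := fun a => D.map_algebraMap a
  have hL : CharZero L := charZero_of_injective_algebraMap (algebraMap K L).injective
  -- Since `D T = 0`, the double and triple poles of the product have explicit antiderivatives,
  -- which are absorbed into `ψ`; only the simple pole remains.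
  refine ⟨F + (algebraMap K L (q0 * κ1) * T + algebraMap K L (b0 * κ1)) / X +
    algebraMap K L (κ0 * κ1 / 2) / (X * X), ?_⟩
  simp only [map_add, Derivation.leibniz_div, Derivation.leibniz, hK, hDX, hDT, smul_eq_mul] at h ⊢
  rw [← h]
  simp only [map_mul, map_sub, map_div₀, map_ofNat]
  field_simp
  ring

lemma inclRat_algebraMap (p : MvPolynomial (Fin 2) ℂ) :
    inclRat (algebraMap _ (RatFun 2) p) = algebraMap _ (RatFun 3) (rename Fin.castSucc p) :=
  by simp [inclRat, IsFractionRing.map]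

lemma not_isExact_gTauH {A B : GL (Fin 3) ℂ} (h : UpsilonEq A.val B.val) (hγ : A.val 2 1 ≠ 0) :
    ¬ IsExact (gTauH A B) := by
  rintro ⟨-, Φ, ⟨-, hω⟩, hΦ⟩
  have hAdet : A.val.det ≠ 0 := (Matrix.isUnits_det_units A).ne_zero
  have hBdet : B.val.det ≠ 0 := (Matrix.isUnits_det_units B).ne_zero
  have hf2 := gthTriple_two h
  obtain ⟨h20, hB0, hB1, hdet⟩ := h
  set γ := A.val 2 1 with hγdef
  set δ := A.val 2 2 with hδdef
  set c := γ * B.val 1 2 + δ * B.val 2 2 with hcdef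
  have hc : c ≠ 0 := by
    rintro hc
    rw [hc] at hdet
    simp [hAdet, hBdet] at hdet
  -- a constant vector field along which `h₀` is constant and `h₂` has derivative `1`
  obtain ⟨w, hw0, hw1, hw2⟩ : ∃ w, B.val.mulVec w 0 = 0 ∧ B.val.mulVec w 1 = -δ / γ ∧
      B.val.mulVec w 2 = 1 := by
    obtain ⟨w, hw⟩ := exists_eval_linTriple_eq B ![0, -δ / γ, 1]
    simp only [eval_linTriple] at hw
    exact ⟨w, hw 0, hw 1, hw 2⟩
  simp only [Matrix.mulVec, dotProduct, Fin.sum_univ_three] at hw0 hw1 hw2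
  -- `γ h₁ + δ h₂ = c z₂` on linear forms, and the left side vanishes on `w`; so the field is
  -- tangent to the affine chart.
  have hwz : w 2 = 0 := by
    have : c * w 2 = 0 := by
      have h1 : γ * (-δ / γ) + δ * 1 = 0 := by
        field_simp
        ring
      rw [← hw1, ← hw2] at h1
      linear_combination h1 - w 0 * hB0 - w 1 * hB1
    simpa [hc] using this
  simp only [hwz, mul_zero, add_zero] at hw0 hw1 hw2
  set g := algebraMap (MvPolynomial (Fin 3) ℂ) (RatFun 3) with hg
  have hgC : ∀ a : ℂ, g (C a) = algebraMap ℂ (RatFun 3) a := fun a =>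
    (IsScalarTower.algebraMap_apply ℂ (MvPolynomial (Fin 3) ℂ) (RatFun 3) a).symm
  set d : Derivation ℂ (MvPolynomial (Fin 3) ℂ) (MvPolynomial (Fin 3) ℂ) :=
    (C (w 0) : MvPolynomial (Fin 3) ℂ) • pderiv 0 + (C (w 1) : MvPolynomial (Fin 3) ℂ) • pderiv 1
    with hd
  set D : Derivation ℂ (RatFun 3) (RatFun 3) :=
    g (C (w 0) : MvPolynomial (Fin 3) ℂ) • partialD 0 +
      g (C (w 1) : MvPolynomial (Fin 3) ℂ) • partialD 1 with hDdef
  have hD : ∀ p : MvPolynomial (Fin 3) ℂ, D (g p) = g (d p) := fun p => by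
    simp [hDdef, hd, hg, partialD_algebraMap, Algebra.smul_def]
  -- The contact equation contracted with the field: its right side is a polynomial, so it has no
  -- pole.
  have hω' : Φ 0 * D (Φ 1) + D (Φ 2) = g (C (w 1) * X 0 : MvPolynomial (Fin 3) ℂ) := by
    have hlift : ∀ f, D.liftKaehlerDifferential (dd f) = D f := fun f =>
      D.liftKaehlerDifferential_comp_D f
    have := congrArg D.liftKaehlerDifferential hω
    simp only [hlift, map_add, map_smul, smul_eq_mul] at this
    rw [this]
    change g (X 0 : MvPolynomial (Fin 3) ℂ) * D (g (X 1 : MvPolynomial (Fin 3) ℂ)) +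
      D (g (X 2 : MvPolynomial (Fin 3) ℂ)) = _
    simp [hD, hd, mul_comm]
  set l : Fin 3 → MvPolynomial (Fin 3) ℂ := fun i =>
    C (B.val i 0) * X 0 + C (B.val i 1) * X 1 + C (B.val i 2) with hl
  have hdl : ∀ i, d (l i) = C (B.val i 0 * w 0 + B.val i 1 * w 1) := fun i => by
    simp [hd, hl]
    ring
  have hl2 : l 2 ≠ 0 := by
    intro h0
    have := hdl 2
    rw [h0, hw2] at this
    simp at this
  have hX : g (l 2) ≠ 0 := by simpa [hg] using hl2
  have hprime : Prime (l 2) := by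
    refine prime_of_totalDegree_eq_one (le_antisymm ?_ (Nat.one_le_iff_ne_zero.2 fun h0 => ?_))
    · have hCX : ∀ (a : ℂ) (i : Fin 3), (C a * X i : MvPolynomial (Fin 3) ℂ).totalDegree ≤ 1 :=
        fun a i => (totalDegree_mul _ _).trans (by simp)
      refine (totalDegree_add _ _).trans (max_le ((totalDegree_add _ _).trans
        (max_le (hCX _ _) (hCX _ _))) (by simp))
    · have := hdl 2
      rw [totalDegree_eq_zero_iff_eq_C.1 h0, hw2] at this
      simp [hd] at this
  -- Laurent expansion in `h₂`, obtained by substituting `h₁ = (c - δ h₂)/γ`; this is where `γ ≠ 0`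
  -- enters.
  have hφ : ∀ i : Fin 2, Φ i.castSucc =
      algebraMap ℂ _ (A.val i.castSucc 0 / c) * g (l 0) +
      algebraMap ℂ _ (A.val i.castSucc 0 * c / γ ^ 2) / g (l 2) +
      algebraMap ℂ _ (-2 * A.val i.castSucc 0 * δ / γ ^ 2 + A.val i.castSucc 1 / γ) +
      algebraMap ℂ _ (A.val i.castSucc 0 * δ ^ 2 / (γ ^ 2 * c) - A.val i.castSucc 1 * δ / (γ * c) +
        A.val i.castSucc 2 / c) * g (l 2) := fun i => by
    have hren : ∀ j, rename Fin.castSucc (dehom (linTriple B.val j)) = l j := fun j => by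
      simp [dehom_linTriple, hl]
    have hl1 : algebraMap ℂ (RatFun 3) γ * g (l 1) + algebraMap ℂ (RatFun 3) δ * g (l 2) =
        algebraMap ℂ (RatFun 3) c := by
      simp only [← hgC, ← map_mul, ← map_add]
      congr 1
      simp only [hl, hcdef, C_add, C_mul]
      have e0 := congrArg (C (σ := Fin 3)) hB0
      have e1 := congrArg (C (σ := Fin 3)) hB1
      simp only [C_add, C_mul, C_0] at e0 e1
      linear_combination X 0 * e0 + X 1 * e1
    have hcL : algebraMap ℂ (RatFun 3) c ≠ 0 := by simpa using hc
    have hγL : algebraMap ℂ (RatFun 3) γ ≠ 0 := by simpa using hγ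
    have hl1' : g (l 1) = (algebraMap ℂ (RatFun 3) c - algebraMap ℂ (RatFun 3) δ * g (l 2)) /
        algebraMap ℂ (RatFun 3) γ := by
      rw [eq_div_iff hγL]
      linear_combination hl1
    have hden : inclRat (algebraMap _ (RatFun 2) (dehom (gthTriple A.val B.val 2))) =
        algebraMap ℂ (RatFun 3) c * g (l 2) := by
      rw [inclRat_algebraMap, hf2, ← hg, ← hgC, ← map_mul]
      congr 1
      rw [← hren]
      simp [dehom, algebraMap_eq]
    have hnum : inclRat (algebraMap _ (RatFun 2) (dehom (gthTriple A.val B.val i.castSucc))) =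
        algebraMap ℂ (RatFun 3) (A.val i.castSucc 0) * (g (l 0) * g (l 2) + g (l 1) ^ 2) +
        algebraMap ℂ (RatFun 3) (A.val i.castSucc 1) * (g (l 1) * g (l 2)) +
        algebraMap ℂ (RatFun 3) (A.val i.castSucc 2) * g (l 2) ^ 2 := by
      rw [inclRat_algebraMap, ← hg, dehom_gthTriple]
      simp only [map_add, map_mul, map_pow, hren, rename_C, hgC]
    have hΦi := hΦ i
    rw [show gTauH A B i = _ from toAffine_apply _ i, map_div₀] at hΦi
    rw [hΦi]
    change inclRat (algebraMap _ (RatFun 2) (dehom (gthTriple A.val B.val i.castSucc))) /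
      inclRat (algebraMap _ (RatFun 2) (dehom (gthTriple A.val B.val 2))) = _
    rw [hden, hnum, hl1']
    simp only [map_add, map_sub, map_mul, map_div₀, map_pow, map_neg, map_ofNat]
    field_simp
    ring
  have h0 := hφ 0
  have h1 := hφ 1
  simp only [Fin.castSucc_zero, Fin.castSucc_one] at h0 h1
  rw [h0, h1] at hω'
  obtain ⟨ψ, hψ⟩ := exists_residue D hX (by rw [hD, hdl, hw2]; simp)
    (by rw [hD, hdl, hw0]; simp) _ _ _ _ _ _ _ _ _ _ hω'
  simp only [← hgC, ← map_mul, ← map_sub, ← map_add] at hψ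
  have hdvd := dvd_of_mul_derivation_eq D d hD hprime
    (fun h => hprime.not_isUnit (isUnit_of_dvd_one (by simpa [hdl, hw2] using h))) hψ
  rw [dvd_sub_right (Dvd.intro _ rfl)] at hdvd
  -- The residue is the constant `-det A / γ³`; it is nonzero, hence not divisible by the prime
  -- `h₂`.
  refine hprime.not_isUnit (isUnit_of_dvd_unit hdvd ((IsUnit.mk0 _ fun hr => ?_).map C))
  apply hAdet
  rw [Matrix.det_fin_three, h20]
  field_simp at hr
  apply mul_left_cancel₀ hγ
  linear_combination -hr

/-! ### Density -/

/-- On a polynomial curve both conditions are nonvanishing of nonzero one-variable polynomials, so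
they hold together for some parameter. -/
lemma exists_eval_ne_zero_along_curve {σ : Type*} (p : MvPolynomial σ ℂ)
    (q : σ → Polynomial ℂ) (r : Polynomial ℂ) (hr : r ≠ 0)
    (h : eval (fun s => (q s).eval 0) p ≠ 0) :
    ∃ t, eval (fun s => (q s).eval t) p ≠ 0 ∧ r.eval t ≠ 0 := by
  have key : ∀ (p : MvPolynomial σ ℂ) (t : ℂ),
      (aeval q p).eval t = eval (fun s => (q s).eval t) p := fun p t => by
    induction p using MvPolynomial.induction_on with
    | C a => simp
    | add p p' hp hp' => simp only [map_add, Polynomial.eval_add, hp, hp']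
    | mul_X p i hp => simp only [map_mul, Polynomial.eval_mul, hp, aeval_X, eval_X]
  have h1 : aeval q p * r ≠ 0 :=
    mul_ne_zero (fun h0 => h (by rw [← key, h0, Polynomial.eval_zero])) hr
  obtain ⟨t, ht⟩ : ∃ t, (aeval q p * r).eval t ≠ 0 := by
    by_contra! h2
    exact h1 (Polynomial.funext fun t => by simpa using h2 t)
  rw [Polynomial.eval_mul, key] at ht
  exact ⟨t, left_ne_zero_of_mul ht, right_ne_zero_of_mul ht⟩

/-- The matrix `(1, 0, 0; 0, 1, 0; 0, t, 1)`. -/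
noncomputable def shear (t : ℂ) : GL (Fin 3) ℂ :=
  .mkOfDetNeZero !![1, 0, 0; 0, 1, 0; 0, t, 1] (by simp [Matrix.det_fin_three])

lemma shear_val (t : ℂ) : (shear t).val = !![1, 0, 0; 0, 1, 0; 0, t, 1] := rfl

lemma mul_shear_apply (A : GL (Fin 3) ℂ) (t : ℂ) (i j : Fin 3) :
    (A * shear t).val i j = A.val i j + if j = 1 then t * A.val i 2 else 0 := by
  rw [Units.val_mul, shear_val, Matrix.mul_apply, Fin.sum_univ_three]
  fin_cases j <;> simp [mul_comm]

lemma shear_mul_apply (B : GL (Fin 3) ℂ) (t : ℂ) (i j : Fin 3) :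
    (shear t * B).val i j = B.val i j + if i = 2 then t * B.val 1 j else 0 := by
  rw [Units.val_mul, shear_val, Matrix.mul_apply, Fin.sum_univ_three]
  fin_cases i <;> simp [add_comm]

/-- When `γ₆ = 0`, the remaining equations involve only the last row of `A * B` and `det A * det B`.
Inserting `shear t` and its inverse `shear (-t)` changes neither, and leaves the first column of `A`
alone. -/
lemma UpsilonEq.shear {A B : GL (Fin 3) ℂ} (h : UpsilonEq A.val B.val) (t : ℂ) :
    UpsilonEq (A * shear t).val (ContactBir.shear (-t) * B).val := by
  obtain ⟨h1, h2, h3, h4⟩ := h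
  have hdet : ∀ t, (ContactBir.shear t).val.det = 1 := fun t => by
    simp [shear_val, Matrix.det_fin_three]
  have hd : (A * ContactBir.shear t).val.det * (ContactBir.shear (-t) * B).val.det =
      A.val.det * B.val.det := by
    simp only [Units.val_mul, Matrix.det_mul, hdet, mul_one, one_mul]
  refine ⟨?_, ?_, ?_, hd.trans (h4.trans ?_)⟩ <;>
    simp only [mul_shear_apply, shear_mul_apply] <;> simp
  · exact h1
  · linear_combination h2
  · linear_combination h3
  · ring

lemma UpsilonEq.row_ne_zero {A : GL (Fin 3) ℂ} {B : Matrix (Fin 3) (Fin 3) ℂ}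
    (h : UpsilonEq A.val B) : ¬ (A.val 2 1 = 0 ∧ A.val 2 2 = 0) := fun h' => by
  refine (Matrix.isUnits_det_units A).ne_zero (Matrix.det_eq_zero_of_row_eq_zero 2 fun j => ?_)
  fin_cases j
  · exact h.1
  · exact h'.1
  · exact h'.2

/-- This turns the condition on `𝔤` into one on `h₂`, visible in the coefficients of `f₂ = c z₂ h₂`.
-/
lemma UpsilonEq.ne_zero_iff {A B : GL (Fin 3) ℂ} (h : UpsilonEq A.val B.val) :
    A.val 2 1 ≠ 0 ↔ B.val 2 0 ≠ 0 ∨ B.val 2 1 ≠ 0 := by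
  have hrow := h.row_ne_zero
  obtain ⟨-, h2, h3, -⟩ := h
  constructor
  · intro hγ
    by_contra! hB
    rw [hB.1, mul_zero, add_zero] at h2
    rw [hB.2, mul_zero, add_zero] at h3
    apply (Matrix.isUnits_det_units B).ne_zero
    have h10 : B.val 1 0 = 0 := by simpa [hγ] using h2
    have h11 : B.val 1 1 = 0 := by simpa [hγ] using h3
    rw [Matrix.det_fin_three, h10, h11, hB.1, hB.2]
    ring
  · intro hB hγ
    rw [hγ, zero_mul, zero_add] at h2 h3
    have hδ : A.val 2 2 ≠ 0 := fun h => hrow ⟨hγ, h⟩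
    simp only [mul_eq_zero, hδ, false_or] at h2 h3
    tauto

/-- The polynomial in `t` with values `A * shear t`. -/
noncomputable def mulShearPoly (A : Matrix (Fin 3) (Fin 3) ℂ) (i j : Fin 3) : Polynomial ℂ :=
  Polynomial.C (A i j) + if j = 1 then Polynomial.X * Polynomial.C (A i 2) else 0

/-- The polynomial in `t` with values `shear (-t) * B`. -/
noncomputable def shearMulPoly (B : Matrix (Fin 3) (Fin 3) ℂ) (i j : Fin 3) : Polynomial ℂ :=
  Polynomial.C (B i j) + if i = 2 then -Polynomial.X * Polynomial.C (B 1 j) else 0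

lemma eval_mulShearPoly (A : GL (Fin 3) ℂ) (t : ℂ) (i j : Fin 3) :
    (mulShearPoly A.val i j).eval t = (A * shear t).val i j := by
  rw [mulShearPoly, mul_shear_apply]
  split_ifs
  · simp only [Polynomial.eval_add, Polynomial.eval_mul, Polynomial.eval_X, Polynomial.eval_C]
  · simp

lemma eval_shearMulPoly (B : GL (Fin 3) ℂ) (t : ℂ) (i j : Fin 3) :
    (shearMulPoly B.val i j).eval t = (shear (-t) * B).val i j := by
  rw [shearMulPoly, shear_mul_apply]
  split_ifs
  · simp only [Polynomial.eval_add, Polynomial.eval_mul, Polynomial.eval_neg, Polynomial.eval_X,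
      Polynomial.eval_C]
  · simp

lemma mulShearPoly_two_one_ne_zero {A : GL (Fin 3) ℂ} {B : Matrix (Fin 3) (Fin 3) ℂ}
    (h : UpsilonEq A.val B) : mulShearPoly A.val 2 1 ≠ 0 := fun h0 => by
  have e0 := eval_mulShearPoly A 0 2 1
  have e1 := eval_mulShearPoly A 1 2 1
  rw [h0, mul_shear_apply, Polynomial.eval_zero] at e0 e1
  simp at e0 e1
  refine h.row_ne_zero ⟨e0.symm, ?_⟩
  rw [← e0, zero_add] at e1
  exact e1.symm

lemma shear_zero : shear 0 = 1 := by
  apply Units.ext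
  rw [shear_val]
  ext i j
  fin_cases i <;> fin_cases j <;> rfl

/-- The coefficients of `𝔤 τ 𝔥` as polynomials in the entries of the matrices. -/
def gthCoeff {R : Type*} [CommRing R] (A B : Fin 3 → Fin 3 → R) (i k l : Fin 3) : R :=
  A i 0 * (B 0 k * B 2 l + B 1 k * B 1 l) + A i 1 * (B 1 k * B 2 l) + A i 2 * (B 2 k * B 2 l)

lemma coeff_gthTriple (A B : Matrix (Fin 3) (Fin 3) ℂ) (i : Fin 3) (m : Fin 3 →₀ ℕ) :
    (gthTriple A B i).coeff m =
      ∑ k, ∑ l, gthCoeff A B i k l * (X k * X l : MvPolynomial (Fin 3) ℂ).coeff m := by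
  have : gthTriple A B i = ∑ k, ∑ l, C (gthCoeff A B i k l) * (X k * X l) := by
    rw [gthTriple_apply]
    simp only [linTriple, gthCoeff, Fin.sum_univ_three, map_add, map_mul]
    ring
  rw [this]
  simp only [coeff_sum, coeff_C_mul]

lemma exists_shear_quad {A B : GL (Fin 3) ℂ} (h : UpsilonEq A.val B.val)
    (p : MvPolynomial (Fin 3 × (Fin 3 →₀ ℕ)) ℂ)
    (hp : eval (fun im => (gthTriple A.val B.val im.1).coeff im.2) p ≠ 0) :
    ∃ t, eval (fun im => (gthTriple (A * shear t).val (shear (-t) * B).val im.1).coeff im.2) p ≠ 0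
      ∧ (A * shear t).val 2 1 ≠ 0 := by
  have key : ∀ t (im : Fin 3 × (Fin 3 →₀ ℕ)), (∑ k, ∑ l,
      gthCoeff (mulShearPoly A.val) (shearMulPoly B.val) im.1 k l *
      Polynomial.C ((X k * X l : MvPolynomial (Fin 3) ℂ).coeff im.2)).eval t =
      (gthTriple (A * shear t).val (shear (-t) * B).val im.1).coeff im.2 := fun t im => by
    simp only [coeff_gthTriple, gthCoeff, Polynomial.eval_finsetSum, Polynomial.eval_mul,
      Polynomial.eval_add, Polynomial.eval_C, eval_mulShearPoly, eval_shearMulPoly]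
  obtain ⟨t, ht, ht'⟩ := exists_eval_ne_zero_along_curve p (fun im => ∑ k, ∑ l,
    gthCoeff (mulShearPoly A.val) (shearMulPoly B.val) im.1 k l *
      Polynomial.C ((X k * X l : MvPolynomial (Fin 3) ℂ).coeff im.2)) (mulShearPoly A.val 2 1)
    (mulShearPoly_two_one_ne_zero h) (by
      simp only [key, shear_zero, neg_zero, mul_one, one_mul]
      exact hp)
  simp only [key, eval_mulShearPoly] at ht ht'
  exact ⟨t, ht, ht'⟩

lemma exists_shear_pair {A B : GL (Fin 3) ℂ} (h : UpsilonEq A.val B.val)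
    (p : MvPolynomial ((Fin 3 × Fin 3) ⊕ (Fin 3 × Fin 3)) ℂ)
    (hp : eval (Sum.elim (fun ij => A.val ij.1 ij.2) (fun ij => B.val ij.1 ij.2)) p ≠ 0) :
    ∃ t, eval (Sum.elim (fun ij => (A * shear t).val ij.1 ij.2)
      (fun ij => (shear (-t) * B).val ij.1 ij.2)) p ≠ 0 ∧ (A * shear t).val 2 1 ≠ 0 := by
  have key : ∀ t, (fun s => (Sum.elim (fun ij : Fin 3 × Fin 3 => mulShearPoly A.val ij.1 ij.2)
      (fun ij : Fin 3 × Fin 3 => shearMulPoly B.val ij.1 ij.2) s).eval t) =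
      Sum.elim (fun ij => (A * shear t).val ij.1 ij.2)
        (fun ij => (shear (-t) * B).val ij.1 ij.2) := fun t => by
    ext s
    rcases s with s | s
    · exact eval_mulShearPoly A t _ _
    · exact eval_shearMulPoly B t _ _
  obtain ⟨t, ht, ht'⟩ := exists_eval_ne_zero_along_curve p
    (Sum.elim (fun ij : Fin 3 × Fin 3 => mulShearPoly A.val ij.1 ij.2)
      (fun ij : Fin 3 × Fin 3 => shearMulPoly B.val ij.1 ij.2)) (mulShearPoly A.val 2 1)
    (mulShearPoly_two_one_ne_zero h) (by
      rw [key, shear_zero, neg_zero, shear_zero, mul_one, one_mul]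
      exact hp)
  rw [key, eval_mulShearPoly] at *
  exact ⟨t, ht, ht'⟩

lemma upsilonEq_one : UpsilonEq (1 : GL (Fin 3) ℂ).val (1 : GL (Fin 3) ℂ).val := by
  simp [UpsilonEq]

lemma isZariskiOpenIn_self {P σ : Type} (coords : P → Set (σ → ℂ)) (S : Set P)
    (h : ∀ x ∈ S, (coords x).Nonempty) : IsZariskiOpenIn coords S S := by
  refine ⟨{1}, Set.ext fun x => ⟨fun hx => ⟨hx, 1, rfl, (h x hx).some, (h x hx).some_mem, ?_⟩,
    fun hx => hx.1⟩⟩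
  simp

lemma IsZariskiDenseIn.nonempty {P σ : Type} {coords : P → Set (σ → ℂ)} {S U : Set P}
    (hU : IsZariskiDenseIn coords S U) (h : ∀ x ∈ S, (coords x).Nonempty) (hS : S.Nonempty) :
    U.Nonempty :=
  (hU S (isZariskiOpenIn_self coords S h) hS).mono Set.inter_subset_right

lemma coeff_gthTriple_two {A B : Matrix (Fin 3) (Fin 3) ℂ} (h : UpsilonEq A B) (j : Fin 3) :
    (gthTriple A B 2).coeff (Finsupp.single j 1 + Finsupp.single 2 1) =
      (A 2 1 * B 1 2 + A 2 2 * B 2 2) * B 2 j := by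
  rw [gthTriple_two h, coeff_C_mul, mul_comm (X 2), coeff_mul_X]
  congr 1
  simp [linTriple, coeff_sum, coeff_C_mul, coeff_X, Finsupp.single_left_inj]

lemma UpsilonEq.const_ne_zero {A B : GL (Fin 3) ℂ} (h : UpsilonEq A.val B.val) :
    A.val 2 1 * B.val 1 2 + A.val 2 2 * B.val 2 2 ≠ 0 := fun h0 => by
  have := h.2.2.2
  rw [h0] at this
  simp [(Matrix.isUnits_det_units A).ne_zero, (Matrix.isUnits_det_units B).ne_zero] at this

/-! ### The open dense sets of non-exact maps -/

theorem exists_open_dense_quadBirEta :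
    ∃ U : Set (Fin 2 → RatFun 2), IsZariskiOpenIn quadCoords QuadBirEta U ∧ U.Nonempty ∧
      IsZariskiDenseIn quadCoords QuadBirEta U ∧ ∀ φ ∈ U, ¬ IsExact φ := by
  -- The coefficients of `z₀ z₂` and `z₁ z₂` in `f₂`: both vanish exactly when `γ₇ = 0`.
  set I : Set (MvPolynomial (Fin 3 × (Fin 3 →₀ ℕ)) ℂ) :=
    {X (2, Finsupp.single 0 1 + Finsupp.single 2 1),
      X (2, Finsupp.single 1 1 + Finsupp.single 2 1)} with hI
  have hdense : IsZariskiDenseIn quadCoords QuadBirEta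
      {φ | φ ∈ QuadBirEta ∧ ∃ p ∈ I, ∃ c ∈ quadCoords φ, eval c p ≠ 0} := by
    rintro V ⟨J, rfl⟩ ⟨φ, ⟨hφ, -⟩, p, hp, c, ⟨f, hf, rfl⟩, hpc⟩
    obtain ⟨A, B, h, rfl, rfl⟩ := exists_upsilonEq_of_isGivenBy hφ hf
    obtain ⟨t, ht, ht'⟩ := exists_shear_quad h p hpc
    have ht2 := h.shear t
    refine ⟨gTauH (A * shear t) (shear (-t) * B), ⟨gTauH_mem_QuadBirEta ht2, p, hp, _,
      ⟨_, isGivenBy_gTauH _ _, rfl⟩, ht⟩, gTauH_mem_QuadBirEta ht2, ?_⟩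
    rcases ht2.ne_zero_iff.1 ht' with h0 | h0
    · refine ⟨_, Or.inl rfl, _, ⟨_, isGivenBy_gTauH _ _, rfl⟩, ?_⟩
      rw [eval_X, coeff_gthTriple_two ht2]
      exact mul_ne_zero ht2.const_ne_zero h0
    · refine ⟨_, Or.inr rfl, _, ⟨_, isGivenBy_gTauH _ _, rfl⟩, ?_⟩
      rw [eval_X, coeff_gthTriple_two ht2]
      exact mul_ne_zero ht2.const_ne_zero h0
  refine ⟨_, ⟨I, rfl⟩, hdense.nonempty ?_ ⟨_, gTauH_mem_QuadBirEta upsilonEq_one⟩, hdense, ?_⟩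
  · rintro φ ⟨-, f, hf⟩
    exact ⟨_, f, hf, rfl⟩
  · rintro φ ⟨⟨hφ, -⟩, p, hp, c, ⟨f, hf, rfl⟩, hpc⟩
    obtain ⟨A, B, h, rfl, rfl⟩ := exists_upsilonEq_of_isGivenBy hφ hf
    refine not_isExact_gTauH h (h.ne_zero_iff.2 ?_)
    rcases hp with rfl | rfl <;> rw [eval_X, coeff_gthTriple_two h] at hpc
    · exact Or.inl (right_ne_zero_of_mul hpc)
    · exact Or.inr (right_ne_zero_of_mul hpc)

theorem exists_open_dense_Upsilon :
    ∃ Υ' : Set (AutP2 × AutP2), IsZariskiOpenIn pairCoords Upsilon Υ' ∧ Υ'.Nonempty ∧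
      IsZariskiDenseIn pairCoords Upsilon Υ' ∧
      ∀ A B : GL (Fin 3) ℂ, (toAut A, toAut B) ∈ Υ' → ¬ IsExact (gTauH A B) := by
  set I : Set (MvPolynomial ((Fin 3 × Fin 3) ⊕ (Fin 3 × Fin 3)) ℂ) := {X (Sum.inl (2, 1))} with hI
  have hdense : IsZariskiDenseIn pairCoords Upsilon
      {x | x ∈ Upsilon ∧ ∃ p ∈ I, ∃ c ∈ pairCoords x, eval c p ≠ 0} := by
    rintro V ⟨J, rfl⟩ ⟨x, hx, p, hp, c, ⟨A, B, rfl, rfl⟩, hpc⟩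
    have h := (mem_Upsilon_iff A B).1 hx
    obtain ⟨t, ht, ht'⟩ := exists_shear_pair h p hpc
    have ht2 := (mem_Upsilon_iff _ _).2 (h.shear t)
    exact ⟨(toAut (A * shear t), toAut (shear (-t) * B)), ⟨ht2, p, hp, _, ⟨_, _, rfl, rfl⟩, ht⟩,
      ht2, _, rfl, _, ⟨_, _, rfl, rfl⟩, by rw [eval_X]; exact ht'⟩
  refine ⟨_, ⟨I, rfl⟩, hdense.nonempty ?_ ⟨_, (mem_Upsilon_iff _ _).2 upsilonEq_one⟩, hdense, ?_⟩
  · rintro x ⟨A, B, rfl, -⟩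
    exact ⟨_, A, B, rfl, rfl⟩
  · rintro A B ⟨hAB, p, rfl, c, ⟨A', B', h, rfl⟩, hpc⟩
    refine not_isExact_gTauH ((mem_Upsilon_iff A B).1 hAB) fun h0 => hpc ?_
    -- The matrix witnessing openness may differ from `A` by a scalar, which does not affect the
    -- vanishing of `γ₇`.
    obtain ⟨k, -, hk⟩ := toAut_eq_toAut_iff.1 (Prod.mk.inj h).1
    rw [eval_X, hk]
    simp [h0]

end ContactBir

theorem mainTheorem6 :
    -- a generic quadratic element of `Bir(ℂ²)_η` is not exact
    (∃ U : Set (Fin 2 → ContactBir.RatFun 2),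
      ContactBir.IsZariskiOpenIn ContactBir.quadCoords ContactBir.QuadBirEta U ∧
      U.Nonempty ∧
      ContactBir.IsZariskiDenseIn ContactBir.quadCoords ContactBir.QuadBirEta U ∧
      ∀ φ ∈ U, ¬ ContactBir.IsExact φ) ∧
    -- the quadratic elements of `Bir(ℂ²)_η` are the maps `𝔤 τ 𝔥` with `(𝔤, 𝔥)` in `Υ`
    (∀ φ : Fin 2 → ContactBir.RatFun 2, φ ∈ ContactBir.QuadBirEta ↔
      ∃ A B : GL (Fin 3) ℂ, (ContactBir.toAut A, ContactBir.toAut B) ∈ ContactBir.Upsilon ∧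
        φ = ContactBir.gTauH A B) ∧
    -- a nonempty Zariski-open (and dense) subset of `Υ` none of whose members gives an exact map
    (∃ Υ' : Set (ContactBir.AutP2 × ContactBir.AutP2),
      ContactBir.IsZariskiOpenIn ContactBir.pairCoords ContactBir.Upsilon Υ' ∧
      Υ'.Nonempty ∧
      ContactBir.IsZariskiDenseIn ContactBir.pairCoords ContactBir.Upsilon Υ' ∧
      ∀ A B : GL (Fin 3) ℂ, (ContactBir.toAut A, ContactBir.toAut B) ∈ Υ' →
        ¬ ContactBir.IsExact (ContactBir.gTauH A B)) :=
  ⟨ContactBir.exists_open_dense_quadBirEta, ContactBir.mem_QuadBirEta_iff,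
    ContactBir.exists_open_dense_Upsilon⟩
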